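/- Let $\mathbb{E}^3_1$ be $\mathbb{R}^3$ with the Minkowski product $\langle v,w\rangle=-v_1w_1+v_2w_2+v_3w_3$, let $v\wedge w$ be the vector determined by $\langle v\wedge w,z\rangle=\det(v,w,z)$ for all $z$, and put $\mathbb{H}^2(-1)=\{y\in\mathbb{E}^3_1:\langle y,y\rangle=-1\}$. Let $x:M\to\mathbb{E}^3_1$ be a smooth space-like immersion of an oriented surface (i.e. the induced metric is positive definite), with smooth unit normal field $N$, $\langle N,N\rangle=-1$, and shape operator $S$ given by $dN(X)=-dx(SX)$. Assume that $M$ lies in the time-like cone, i.e. $\langle x,x\rangle<0$ on $M$. Call $M$ a generalized constant ratio (GCR) surface if at every point the tangential part $x^T$ of the position vector is a principal direction, i.e. a non-zero eigenvector of $S$, and call $M$ flat if the Riemann curvature tensor of its induced metric vanishes. Then $M$ is a flat GCR surface if and only if every point of $M$ has a neighbourhood with smooth local coordinates $(s,t)$, with $s$ and $t$ ranging in open intervals $I$ and $J$, in which $$x(s,t)=s\bigl(\cosh u(s)\,\varphi(t)+\sinh u(s)\,\varphi(t)\wedge\varphi'(t)\bigr),\qquad u(s)=c_1-\operatorname{arccosh}\frac{c_2}{s},$$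 where $\varphi:J\to\mathbb{H}^2(-1)$ is a smooth curve parametrized by arc length ($\langle\varphi',\varphi'\rangle=1$), $c_1,c_2$ are real constants, and $c_2/s>1$ for all $s\in I$ (so that $u$ is defined and smooth on $I$). -/

import Mathlib

open scoped Manifold ContDiff

noncomputable section

/-- The underlying vector space of the Minkowski 3-space. -/
abbrev E31 : Type := Fin 3 → ℝ

/-- The coordinate plane on which surfaces are modelled. -/
abbrev Plane : Type := EuclideanSpace ℝ (Fin 2)

/-- The Minkowski product `⟨v, w⟩ = -v₀ w₀ + v₁ w₁ + v₂ w₂`. -/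
def mink (v w : E31) : ℝ := -(v 0 * w 0) + v 1 * w 1 + v 2 * w 2

/-- The Lorentzian cross product `v ∧ w`; see `mink_lcross` for its characterization. -/
def lcross (v w : E31) : E31 :=
  ![-(v 1 * w 2 - v 2 * w 1), v 2 * w 0 - v 0 * w 2, v 0 * w 1 - v 1 * w 0]

/-- `⟨v ∧ w, z⟩` is the determinant of the matrix with columns `v`, `w`, `z`. -/
theorem mink_lcross (v w z : E31) :
    mink (lcross v w) z = (Matrix.of ![v, w, z]).transpose.det := by
  rw [Matrix.det_transpose, Matrix.det_fin_three]
  simp [mink, lcross]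
  ring

/-! ### Intrinsic curvature of a metric in two coordinates -/

/-- The partial derivative `∂ᵢ h` at `z`. -/
def partialD (i : Fin 2) (h : Plane → ℝ) (z : Plane) : ℝ :=
  fderiv ℝ h z (EuclideanSpace.single i 1)

/-- The matrix `(⟨∂ᵢ f, ∂ⱼ f⟩)` of the metric induced by a map `f` on coordinates. -/
def inducedMetric (f : Plane → E31) (z : Plane) : Matrix (Fin 2) (Fin 2) ℝ :=
  Matrix.of fun i j =>
    mink (fderiv ℝ f z (EuclideanSpace.single i 1)) (fderiv ℝ f z (EuclideanSpace.single j 1))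

/-- The Christoffel symbols `Γᵏᵢⱼ` of the Levi-Civita connection of the metric `g`. -/
def christoffel (g : Plane → Matrix (Fin 2) (Fin 2) ℝ) (k i j : Fin 2) (z : Plane) : ℝ :=
  (1 / 2 : ℝ) * ∑ l, (g z)⁻¹ k l *
    (partialD i (fun y => g y j l) z + partialD j (fun y => g y i l) z
      - partialD l (fun y => g y i j) z)

/-- The components of the Riemann curvature tensor of the metric `g`:
`R(∂ᵢ, ∂ⱼ) ∂ₖ = ∑ₗ Rˡₖᵢⱼ ∂ₗ`. -/
def riemann (g : Plane → Matrix (Fin 2) (Fin 2) ℝ) (l k i j : Fin 2) (z : Plane) : ℝ :=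
  partialD i (christoffel g l j k) z - partialD j (christoffel g l i k) z
    + ∑ m, (christoffel g l i m z * christoffel g m j k z
      - christoffel g l j m z * christoffel g m i k z)

section Surfaces

variable {M : Type*} [TopologicalSpace M] [ChartedSpace Plane M]

/-- The differential `dx_p(v)` of a map from the surface to the Minkowski space. -/
def dmap (x : M → E31) (p : M) (v : TangentSpace (𝓡 2) p) : E31 :=
  mfderiv (𝓡 2) 𝓘(ℝ, E31) x p v

/-- `x` is a smooth space-like immersion: the induced symmetric form is positive definite
(in particular `dx_p` is injective). -/
def IsSpacelikeImmersion (x : M → E31) : Prop :=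
  ContMDiff (𝓡 2) 𝓘(ℝ, E31) ∞ x ∧
    ∀ (p : M) (v : TangentSpace (𝓡 2) p), v ≠ 0 → 0 < mink (dmap x p v) (dmap x p v)

/-- `N` is a smooth (time-like) unit normal vector field along `x`. -/
def IsUnitNormal (x N : M → E31) : Prop :=
  ContMDiff (𝓡 2) 𝓘(ℝ, E31) ∞ N ∧
    ∀ p : M, mink (N p) (N p) = -1 ∧
      ∀ v : TangentSpace (𝓡 2) p, mink (N p) (dmap x p v) = 0

/-- The surface lies in the time-like cone. -/
def LiesInTimelikeCone (x : M → E31) : Prop := ∀ p : M, mink (x p) (x p) < 0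

/-- `v` is a principal direction at `p`: a non-zero eigenvector of the shape operator `S`, which is
given by the Weingarten formula `dN(w) = -dx(S w)`. -/
def IsPrincipalDirection (x N : M → E31) (p : M) (v : TangentSpace (𝓡 2) p) : Prop :=
  v ≠ 0 ∧ ∃ k : ℝ, dmap N p v = -(k • dmap x p v)

/-- `v` is the tangential part of the position vector at `p`: `x - dx(v)` is normal. -/
def IsTangentialPart (x : M → E31) (p : M) (v : TangentSpace (𝓡 2) p) : Prop :=
  ∀ w : TangentSpace (𝓡 2) p, mink (x p - dmap x p v) (dmap x p w) = 0

/-- Generalized constant ratio surfaces: the tangential part of the position vector is a principal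
direction at every point. -/
def IsGCR (x N : M → E31) : Prop :=
  ∀ p : M, ∃ v : TangentSpace (𝓡 2) p, IsTangentialPart x p v ∧ IsPrincipalDirection x N p v

/-- The induced metric is flat: its Riemann curvature tensor vanishes in every chart. -/
def IsFlatSurface (x : M → E31) : Prop :=
  ∀ e ∈ atlas Plane M, ∀ z ∈ e.target, ∀ l k i j : Fin 2,
    riemann (inducedMetric (x ∘ e.symm)) l k i j z = 0

end Surfaces

/-- `φ` is, on the set `J` of parameters, a smooth curve on `ℍ²(-1) = {y | ⟨y, y⟩ = -1}`
parametrized by arc length. -/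
def IsArclengthCurveInH2 (φ : ℝ → E31) (J : Set ℝ) : Prop :=
  ContDiffOn ℝ ∞ φ J ∧
    ∀ t ∈ J, mink (φ t) (φ t) = -1 ∧ mink (deriv φ t) (deriv φ t) = 1

/-- `x(s, t) = s (cosh u(s) φ(t) + sinh u(s) φ(t) ∧ φ'(t))`. -/
def gcrMap (u : ℝ → ℝ) (φ : ℝ → E31) (s t : ℝ) : E31 :=
  s • (Real.cosh (u s) • φ t + Real.sinh (u s) • lcross (φ t) (deriv φ t))

/-- Near `p` there are smooth local coordinates `(s, t)` of the surface, `s` ranging in the open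
interval `I`, in which the surface is `x = gcrMap u φ s t` for the given smooth `u` on `I` and some
arc-length parametrized curve `φ` on `ℍ²(-1)`. -/
def IsGCRParametrizedNear {M : Type*} [TopologicalSpace M] [ChartedSpace Plane M]
    (x : M → E31) (p : M) (u : ℝ → ℝ) (I : Set ℝ) : Prop :=
  IsOpen I ∧ I.OrdConnected ∧ ContDiffOn ℝ ∞ u I ∧
    ∃ (φ : ℝ → E31) (J : Set ℝ), IsOpen J ∧ J.OrdConnected ∧ IsArclengthCurveInH2 φ J ∧
      ∃ e ∈ IsManifold.maximalAtlas (𝓡 2) ∞ M, p ∈ e.source ∧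
        ∀ q ∈ e.source, e q 0 ∈ I ∧ e q 1 ∈ J ∧ x q = gcrMap u φ (e q 0) (e q 1)

end

noncomputable section

/-! ### Algebra of the Minkowski product -/

/-! The argument turns on the support function `h = ⟨x, N⟩`. The tangential part of `x` is `T = x +
hN`, and `dh(w) = ⟨x, dN w⟩ = ⟨T, dN w⟩`. By self-adjointness of the shape operator `S`, `dh = 0`
exactly when `S T = 0`. The Gauss equation says that the metric is flat exactly when `dN` is
singular at every point. Both conditions on `M` together therefore amount to: `h` is locally
constant and `T` never vanishes.

If `dh = 0` and `T ≠ 0`, then `T` is principal with eigenvalue 0 and `dN` is singular, so the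
surface is flat GCR. Conversely (`fderiv_support_eq_zero`), suppose `S T = k T` and `dN` is
singular, but `dh ≠ 0` at a point. Then `k ≠ 0` nearby, so the principal curvature in the direction
`Q = T ∧ N` vanishes. Comparing the mixed second derivatives of `N` along `T` and `Q` gives `⟨∂_Q T,
Q⟩ = 0`. But `∂_Q T` is `Q` plus a normal vector, and `Q` is space-like: a contradiction.

With `h` constant, write `x = r e - h N`, where `r = |T|` and `e = T / r`. Both `e` and `N` are
constant along the integral curves of `T` (`exists_ruling`), and `s² + r² = h²` for `s² = -⟨x, x⟩`.
A fixed hyperbolic rotation of `N, e` gives `P, Q` depending on one parameter only, with `x = s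
(cosh u P ± sinh u Q)`, `u = c₁ - arcosh(|h| / s)` (`exists_gcr_frame`). Arc length on the curve `P`
supplies `φ` and the coordinate `t` (`exists_gcr_coordinates`). Conversely, the normal form has the
unit normal `cosh c₁ φ + sinh c₁ φ ∧ φ'`, whose product with `x` is the constant `-c₂`
(`of_eq_gcrMap`). -/

theorem mink_comm (v w : E31) : mink v w = mink w v := by simp only [mink]; ring

theorem mink_add_left (u v w : E31) : mink (u + v) w = mink u w + mink v w := by
  simp only [mink, Pi.add_apply]; ring

theorem mink_add_right (u v w : E31) : mink u (v + w) = mink u v + mink u w := by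
  simp only [mink, Pi.add_apply]; ring

theorem mink_sub_left (u v w : E31) : mink (u - v) w = mink u w - mink v w := by
  simp only [mink, Pi.sub_apply]; ring

theorem mink_sub_right (u v w : E31) : mink u (v - w) = mink u v - mink u w := by
  simp only [mink, Pi.sub_apply]; ring

theorem mink_smul_left (a : ℝ) (v w : E31) : mink (a • v) w = a * mink v w := by
  simp only [mink, Pi.smul_apply, smul_eq_mul]; ring

theorem mink_smul_right (a : ℝ) (v w : E31) : mink v (a • w) = a * mink v w := by
  simp only [mink, Pi.smul_apply, smul_eq_mul]; ring

theorem mink_neg_left (v w : E31) : mink (-v) w = -mink v w := by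
  simp only [mink, Pi.neg_apply]; ring

theorem mink_zero_left (w : E31) : mink 0 w = 0 := by simp [mink]

theorem mink_zero_right (w : E31) : mink w 0 = 0 := by simp [mink]

theorem mink_lcross_left (v w : E31) : mink (lcross v w) v = 0 := by
  simp [mink, lcross]; ring

theorem mink_lcross_right (v w : E31) : mink (lcross v w) w = 0 := by
  simp [mink, lcross]; ring

theorem mink_lcross_lcross (v w : E31) :
    mink (lcross v w) (lcross v w) = mink v w ^ 2 - mink v v * mink w w := by
  simp [mink, lcross]; ring

theorem lcross_lcross (u v w : E31) :
    lcross u (lcross v w) = mink u v • w - mink u w • v := by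
  ext i
  fin_cases i <;> simp [mink, lcross] <;> ring

theorem lcross_smul_right (a : ℝ) (v w : E31) : lcross v (a • w) = a • lcross v w := by
  ext i
  fin_cases i <;> simp [lcross] <;> ring

/-- A vector orthogonal to `v`, `w` and `v ∧ w` vanishes if `v ∧ w` is not light-like. -/
theorem eq_zero_of_mink_frame {v w z : E31} (h : mink (lcross v w) (lcross v w) ≠ 0)
    (h₁ : mink z v = 0) (h₂ : mink z w = 0) (h₃ : mink z (lcross v w) = 0) : z = 0 := by
  -- Polynomial identity expanding `z` in the frame `v, w, v ∧ w` by means of the dual frame,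
  -- cleared of its denominator.
  have key : mink (lcross v w) (lcross v w) • z =
      mink z v • lcross w (lcross v w) + mink z w • lcross (lcross v w) v
        + mink z (lcross v w) • lcross v w := by
    ext i
    fin_cases i <;> simp [mink, lcross] <;> ring
  rw [h₁, h₂, h₃] at key
  simpa [h] using key

/-- Expansion in an orthonormal frame `v, w, v ∧ w` with `v` time-like. -/
theorem eq_smul_lcross {v w z : E31} (hv : mink v v = -1) (hw : mink w w = 1) (hvw : mink v w = 0)
    (h₁ : mink z v = 0) (h₂ : mink z w = 0) :
    z = mink z (lcross v w) • lcross v w := by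
  have hc : mink (lcross v w) (lcross v w) = 1 := by rw [mink_lcross_lcross, hv, hw, hvw]; norm_num
  refine sub_eq_zero.mp (eq_zero_of_mink_frame (v := v) (w := w) (by rw [hc]; norm_num) ?_ ?_ ?_)
  · rw [mink_sub_left, mink_smul_left, mink_lcross_left, h₁]; ring
  · rw [mink_sub_left, mink_smul_left, mink_lcross_right, h₂]; ring
  · rw [mink_sub_left, mink_smul_left, hc]; ring

/-! ### Calculus of the Minkowski product -/

section Calculus

variable {E : Type*} [NormedAddCommGroup E] [NormedSpace ℝ E]

theorem ContDiffAt.mink {n : WithTop ℕ∞} {f g : E → E31} {z : E} (hf : ContDiffAt ℝ n f z)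
    (hg : ContDiffAt ℝ n g z) : ContDiffAt ℝ n (fun y => mink (f y) (g y)) z := by
  have hf' := contDiffAt_pi.mp hf
  have hg' := contDiffAt_pi.mp hg
  exact (((hf' 0).mul (hg' 0)).neg.add ((hf' 1).mul (hg' 1))).add ((hf' 2).mul (hg' 2))

theorem ContDiffAt.lcross {n : WithTop ℕ∞} {f g : E → E31} {z : E} (hf : ContDiffAt ℝ n f z)
    (hg : ContDiffAt ℝ n g z) : ContDiffAt ℝ n (fun y => lcross (f y) (g y)) z := by
  have hf' := contDiffAt_pi.mp hf
  have hg' := contDiffAt_pi.mp hg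
  refine contDiffAt_pi.mpr fun i => ?_
  fin_cases i
  · exact (((hf' 1).mul (hg' 2)).sub ((hf' 2).mul (hg' 1))).neg
  · exact ((hf' 2).mul (hg' 0)).sub ((hf' 0).mul (hg' 2))
  · exact ((hf' 0).mul (hg' 1)).sub ((hf' 1).mul (hg' 0))

theorem HasFDerivAt.mink {f g : E → E31} {z : E} {f' g' : E →L[ℝ] E31} (hf : HasFDerivAt f f' z)
    (hg : HasFDerivAt g g' z) :
    ∃ D : E →L[ℝ] ℝ, HasFDerivAt (fun y => mink (f y) (g y)) D z ∧
      ∀ w, D w = mink (f' w) (g z) + mink (f z) (g' w) := by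
  have hf' := hasFDerivAt_pi'.mp hf
  have hg' := hasFDerivAt_pi'.mp hg
  refine ⟨_, (((hf' 0).mul (hg' 0)).neg.add ((hf' 1).mul (hg' 1))).add ((hf' 2).mul (hg' 2)), ?_⟩
  intro w
  simp [_root_.mink]
  ring

theorem DifferentiableAt.mink {f g : E → E31} {z : E} (hf : DifferentiableAt ℝ f z)
    (hg : DifferentiableAt ℝ g z) : DifferentiableAt ℝ (fun y => mink (f y) (g y)) z :=
  let ⟨_, h, _⟩ := hf.hasFDerivAt.mink hg.hasFDerivAt
  h.differentiableAt

theorem fderiv_mink {f g : E → E31} {z : E} (hf : DifferentiableAt ℝ f z)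
    (hg : DifferentiableAt ℝ g z) (w : E) :
    fderiv ℝ (fun y => mink (f y) (g y)) z w
      = mink (fderiv ℝ f z w) (g z) + mink (f z) (fderiv ℝ g z w) := by
  obtain ⟨D, h, hD⟩ := hf.hasFDerivAt.mink hg.hasFDerivAt
  rw [h.fderiv, hD]

theorem deriv_mink {f g : ℝ → E31} {t : ℝ} (hf : DifferentiableAt ℝ f t)
    (hg : DifferentiableAt ℝ g t) :
    deriv (fun y => mink (f y) (g y)) t = mink (deriv f t) (g t) + mink (f t) (deriv g t) := by
  simpa using fderiv_mink hf hg 1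

/-- Product rule for a Minkowski product that is constant near `z`. -/
theorem mink_fderiv_add_of_eventually_const {f g : E → E31} {z : E} {c : ℝ}
    (hf : DifferentiableAt ℝ f z) (hg : DifferentiableAt ℝ g z)
    (h : ∀ᶠ y in nhds z, mink (f y) (g y) = c) (w : E) :
    mink (fderiv ℝ f z w) (g z) + mink (f z) (fderiv ℝ g z w) = 0 := by
  rw [← fderiv_mink hf hg, Filter.EventuallyEq.fderiv_eq (f := fun _ => c) h]
  simp

theorem mink_deriv_add_of_eventually_const {f g : ℝ → E31} {t : ℝ} {c : ℝ}
    (hf : DifferentiableAt ℝ f t) (hg : DifferentiableAt ℝ g t)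
    (h : ∀ᶠ y in nhds t, mink (f y) (g y) = c) :
    mink (deriv f t) (g t) + mink (f t) (deriv g t) = 0 := by
  simpa using mink_fderiv_add_of_eventually_const hf hg h 1

/-- Symmetry of the second derivative, in terms of directional derivatives. -/
theorem fderiv_fderiv_apply_comm {f : E → E31} {z : E} (hf : ContDiffAt ℝ ∞ f z) (v w : E) :
    fderiv ℝ (fun y => fderiv ℝ f y v) z w = fderiv ℝ (fun y => fderiv ℝ f y w) z v := by
  have hd : DifferentiableAt ℝ (fderiv ℝ f) z :=
    (hf.fderiv_right (m := ∞) (by simp)).differentiableAt (by simp)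
  have hs := hf.isSymmSndFDerivAt (by simpa using WithTop.coe_le_coe.2 (le_top : (2 : ℕ∞) ≤ ⊤))
  have key : ∀ a b : E, fderiv ℝ (fun y => fderiv ℝ f y a) z b = fderiv ℝ (fderiv ℝ f) z b a := by
    intro a b
    rw [fderiv_clm_apply hd (differentiableAt_const a)]
    simp
  rw [key, key]
  exact hs.eq w v

theorem ContDiffAt.fderiv_apply_const {F : Type*} [NormedAddCommGroup F] [NormedSpace ℝ F]
    {f : E → F} {z : E} (hf : ContDiffAt ℝ ∞ f z) (v : E) :
    ContDiffAt ℝ ∞ (fun y => fderiv ℝ f y v) z :=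
  (hf.fderiv_right (m := ∞) (by simp)).clm_apply contDiffAt_const

end Calculus

/-! ### Space-like patches -/

/-- A smooth space-like map `f` on the open set `U` of the plane, with a unit normal field `n`. -/
structure SpacelikePatch (f n : Plane → E31) (U : Set Plane) : Prop where
  isOpen : IsOpen U
  smooth : ∀ z ∈ U, ContDiffAt ℝ ∞ f z
  smooth_normal : ∀ z ∈ U, ContDiffAt ℝ ∞ n z
  pos : ∀ z ∈ U, ∀ w, w ≠ 0 → 0 < mink (fderiv ℝ f z w) (fderiv ℝ f z w)
  unit : ∀ z ∈ U, mink (n z) (n z) = -1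
  normal : ∀ z ∈ U, ∀ w, mink (n z) (fderiv ℝ f z w) = 0

namespace SpacelikePatch

variable {f n : Plane → E31} {U : Set Plane} {z : Plane}

theorem mono {V : Set Plane} (H : SpacelikePatch f n U) (hV : IsOpen V) (hVU : V ⊆ U) :
    SpacelikePatch f n V :=
  ⟨hV, fun z hz => H.smooth z (hVU hz), fun z hz => H.smooth_normal z (hVU hz),
    fun z hz => H.pos z (hVU hz), fun z hz => H.unit z (hVU hz), fun z hz => H.normal z (hVU hz)⟩

theorem differentiableAt (H : SpacelikePatch f n U) (hz : z ∈ U) : DifferentiableAt ℝ f z :=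
  (H.smooth z hz).differentiableAt (by simp)

theorem differentiableAt_normal (H : SpacelikePatch f n U) (hz : z ∈ U) :
    DifferentiableAt ℝ n z :=
  (H.smooth_normal z hz).differentiableAt (by simp)

theorem differentiableAt_fderiv (H : SpacelikePatch f n U) (hz : z ∈ U) (w : Plane) :
    DifferentiableAt ℝ (fun y => fderiv ℝ f y w) z :=
  ((H.smooth z hz).fderiv_apply_const (F := E31) w).differentiableAt (by simp)

theorem differentiableAt_fderiv_normal (H : SpacelikePatch f n U) (hz : z ∈ U) (w : Plane) :
    DifferentiableAt ℝ (fun y => fderiv ℝ n y w) z :=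
  ((H.smooth_normal z hz).fderiv_apply_const (F := E31) w).differentiableAt (by simp)

theorem mink_normal_fderiv_normal (H : SpacelikePatch f n U) (hz : z ∈ U) (w : Plane) :
    mink (n z) (fderiv ℝ n z w) = 0 := by
  have h := mink_fderiv_add_of_eventually_const (c := -1) (H.differentiableAt_normal hz)
    (H.differentiableAt_normal hz)
    (Filter.eventually_of_mem (H.isOpen.mem_nhds hz) fun y hy => H.unit y hy) w
  rw [mink_comm] at h
  linarith

theorem mink_normal_snd (H : SpacelikePatch f n U) (hz : z ∈ U) (v w : Plane) :
    mink (fderiv ℝ n z v) (fderiv ℝ f z w)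
      + mink (n z) (fderiv ℝ (fun y => fderiv ℝ f y w) z v) = 0 :=
  mink_fderiv_add_of_eventually_const (c := 0) (H.differentiableAt_normal hz)
    (H.differentiableAt_fderiv hz w)
    (Filter.eventually_of_mem (H.isOpen.mem_nhds hz) fun y hy => H.normal y hy w) v

/-- The shape operator is self-adjoint. -/
theorem shape_symm (H : SpacelikePatch f n U) (hz : z ∈ U) (v w : Plane) :
    mink (fderiv ℝ n z v) (fderiv ℝ f z w) = mink (fderiv ℝ n z w) (fderiv ℝ f z v) := by
  have h₁ := H.mink_normal_snd hz v w
  have h₂ := H.mink_normal_snd hz w v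
  rw [fderiv_fderiv_apply_comm (H.smooth z hz) v w] at h₂
  linarith

theorem eq_zero_of_fderiv_eq_zero (H : SpacelikePatch f n U) (hz : z ∈ U) {w : Plane}
    (hw : fderiv ℝ f z w = 0) : w = 0 := by
  by_contra h
  have := H.pos z hz w h
  rw [hw, mink_zero_left] at this
  exact lt_irrefl _ this

/-- Vectors orthogonal to the normal are tangent. -/
theorem exists_fderiv_eq (H : SpacelikePatch f n U) (hz : z ∈ U) {v : E31}
    (hv : mink (n z) v = 0) : ∃ w, fderiv ℝ f z w = v := by
  let ℓ : E31 →ₗ[ℝ] ℝ :=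
    { toFun := mink (n z)
      map_add' := mink_add_right _
      map_smul' := fun a w => mink_smul_right a _ w }
  have hinj : Function.Injective (fderiv ℝ f z : Plane →ₗ[ℝ] E31) :=
    (injective_iff_map_eq_zero _).mpr fun w hw => H.eq_zero_of_fderiv_eq_zero hz hw
  -- The tangent plane lies in the kernel of `⟨n, ·⟩`. Both have dimension 2, so they coincide.
  have hle : LinearMap.range (fderiv ℝ f z : Plane →ₗ[ℝ] E31) ≤ LinearMap.ker ℓ := by
    rintro _ ⟨w, rfl⟩
    exact H.normal z hz w
  have h₁ : Module.finrank ℝ (LinearMap.range (fderiv ℝ f z : Plane →ₗ[ℝ] E31)) = 2 := by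
    rw [LinearMap.finrank_range_of_inj hinj]; simp
  have hsurj : LinearMap.range ℓ = ⊤ := by
    refine LinearMap.range_eq_top.mpr fun a => ⟨(-a) • n z, ?_⟩
    change mink (n z) ((-a) • n z) = a
    rw [mink_smul_right, H.unit z hz]; ring
  have h₂ := LinearMap.finrank_range_add_finrank_ker ℓ
  rw [hsurj, finrank_top] at h₂
  simp only [Module.finrank_self, Module.finrank_fintype_fun_eq_card, Fintype.card_fin] at h₂
  have heq := Submodule.eq_of_le_of_finrank_eq hle (by omega)
  have : v ∈ LinearMap.range (fderiv ℝ f z : Plane →ₗ[ℝ] E31) := by rw [heq]; exact hv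
  exact this

/-- Tangent vectors orthogonal to the tangent plane vanish. -/
theorem eq_zero_of_mink_eq_zero (H : SpacelikePatch f n U) (hz : z ∈ U) {v : E31}
    (hv : mink (n z) v = 0) (h : ∀ w, mink v (fderiv ℝ f z w) = 0) : v = 0 := by
  obtain ⟨w, rfl⟩ := H.exists_fderiv_eq hz hv
  by_contra hne
  refine (H.pos z hz w ?_).ne' (h w)
  rintro rfl
  simp at hne

/-- The support function `⟨f, n⟩`. -/
theorem fderiv_support (H : SpacelikePatch f n U) (hz : z ∈ U) (w : Plane) :
    fderiv ℝ (fun y => mink (f y) (n y)) z w = mink (f z) (fderiv ℝ n z w) := by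
  rw [fderiv_mink (H.differentiableAt hz) (H.differentiableAt_normal hz), mink_comm,
    H.normal z hz]
  ring

/-- As `⟨n, n⟩ = -1`, the normal component of `f` is `-⟨f, n⟩ n`; hence the plus sign in the
tangential part `f + ⟨f, n⟩ n`. -/
theorem mink_normal_tangential (H : SpacelikePatch f n U) (hz : z ∈ U) :
    mink (n z) (f z + mink (f z) (n z) • n z) = 0 := by
  rw [mink_add_right, mink_smul_right, H.unit z hz, mink_comm]; ring

theorem mink_tangential_fderiv (H : SpacelikePatch f n U) (hz : z ∈ U) (w : Plane) :
    mink (f z + mink (f z) (n z) • n z) (fderiv ℝ f z w) = mink (f z) (fderiv ℝ f z w) := by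
  rw [mink_add_left, mink_smul_left, H.normal z hz]; ring

theorem mink_tangential_fderiv_normal (H : SpacelikePatch f n U) (hz : z ∈ U) (w : Plane) :
    mink (f z + mink (f z) (n z) • n z) (fderiv ℝ n z w) = mink (f z) (fderiv ℝ n z w) := by
  rw [mink_add_left, mink_smul_left, H.mink_normal_fderiv_normal hz]; ring

theorem fderiv_eq_tangential (H : SpacelikePatch f n U) (hz : z ∈ U) {v : Plane}
    (hv : ∀ w, mink (f z - fderiv ℝ f z v) (fderiv ℝ f z w) = 0) :
    fderiv ℝ f z v = f z + mink (f z) (n z) • n z := by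
  refine sub_eq_zero.mp (H.eq_zero_of_mink_eq_zero hz ?_ fun w => ?_)
  · rw [mink_sub_right, H.normal z hz, H.mink_normal_tangential hz]; ring
  · have := hv w
    rw [mink_sub_left] at this ⊢
    rw [H.mink_tangential_fderiv hz]
    linarith

/-- Where the support function is stationary, the tangential part of the position vector is in the
kernel of the shape operator. -/
theorem fderiv_normal_eq_zero (H : SpacelikePatch f n U) (hz : z ∈ U)
    (hh : fderiv ℝ (fun y => mink (f y) (n y)) z = 0) {X : Plane}
    (hX : fderiv ℝ f z X = f z + mink (f z) (n z) • n z) : fderiv ℝ n z X = 0 := by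
  refine H.eq_zero_of_mink_eq_zero hz (H.mink_normal_fderiv_normal hz X) fun w => ?_
  rw [H.shape_symm hz, hX, mink_comm, H.mink_tangential_fderiv_normal hz, ← H.fderiv_support hz, hh]
  rfl

/-- If the tangential part of the position vector is a principal direction and the shape operator is
singular everywhere, then the support function is stationary. -/
theorem fderiv_support_eq_zero (H : SpacelikePatch f n U)
    (hgcr : ∀ z ∈ U, ∃ X, X ≠ 0 ∧ fderiv ℝ f z X = f z + mink (f z) (n z) • n z ∧
      ∃ k : ℝ, fderiv ℝ n z X = -(k • fderiv ℝ f z X))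
    (hker : ∀ z ∈ U, ∃ v, v ≠ 0 ∧ fderiv ℝ n z v = 0) (hz : z ∈ U) :
    fderiv ℝ (fun y => mink (f y) (n y)) z = 0 := by
  by_contra hne
  -- `T` is the tangential part of the position vector; `Q` is tangent, orthogonal to `T` and of the
  -- same length, so it spans the other principal direction.
  set T : Plane → E31 := fun y => f y + mink (f y) (n y) • n y with hT
  set Q : Plane → E31 := fun y => lcross (T y) (n y) with hQ
  have hTn : ∀ y ∈ U, mink (T y) (n y) = 0 := fun y hy => by
    rw [mink_comm]; exact H.mink_normal_tangential hy
  have hTsm : ∀ y ∈ U, ContDiffAt ℝ ∞ T y := fun y hy =>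
    (H.smooth y hy).add (((H.smooth y hy).mink (H.smooth_normal y hy)).smul (H.smooth_normal y hy))
  have hQsm : ∀ y ∈ U, ContDiffAt ℝ ∞ Q y := fun y hy =>
    (hTsm y hy).lcross (H.smooth_normal y hy)
  have hQQ : ∀ y ∈ U, mink (Q y) (Q y) = mink (T y) (T y) := fun y hy => by
    rw [hQ]; simp only
    rw [mink_lcross_lcross, hTn y hy, H.unit y hy]; ring
  -- the principal direction orthogonal to `T`
  have hprin : ∀ y ∈ U, ∃ X Y : Plane, ∃ k : ℝ, fderiv ℝ f y X = T y ∧ fderiv ℝ f y Y = Q y ∧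
      fderiv ℝ n y X = -(k • T y) ∧ 0 < mink (T y) (T y) ∧
      (∀ w, mink (fderiv ℝ n y w) (T y) = -k * mink (fderiv ℝ f y w) (T y)) ∧
      ∃ l : ℝ, fderiv ℝ n y Y = l • Q y := by
    intro y hy
    obtain ⟨X, hX0, hX, k, hk⟩ := hgcr y hy
    obtain ⟨Y, hY⟩ := H.exists_fderiv_eq hy (v := Q y)
      (by rw [mink_comm]; exact mink_lcross_right _ _)
    have hpos : 0 < mink (T y) (T y) := by
      have := H.pos y hy X hX0
      rwa [hX] at this
    have hsym : ∀ w, mink (fderiv ℝ n y w) (T y) = -k * mink (fderiv ℝ f y w) (T y) := by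
      intro w
      have h1 := H.shape_symm hy w X
      rw [hk, hX] at h1
      rw [h1, mink_neg_left, mink_smul_left, mink_comm (fderiv ℝ f y w)]
      ring
    refine ⟨X, Y, k, hX, hY, by rw [hk, hX], hpos, hsym, ?_⟩
    refine ⟨mink (fderiv ℝ n y Y) (Q y) / mink (T y) (T y), sub_eq_zero.mp
      (eq_zero_of_mink_frame (v := T y) (w := n y) ?_ ?_ ?_ ?_)⟩
    · exact (hQQ y hy).trans_ne hpos.ne'
    · rw [mink_sub_left, hsym, hY, mink_smul_left, mink_lcross_left]; ring
    · rw [mink_sub_left, mink_smul_left, mink_lcross_right, mink_comm,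
        H.mink_normal_fderiv_normal hy]; ring
    · change mink (_ - _ • Q y) (Q y) = 0
      rw [mink_sub_left, mink_smul_left, hQQ y hy, div_mul_cancel₀ _ hpos.ne', sub_self]
  -- off the zero set of the differential of the support function, the other curvature vanishes
  have hzero : ∀ y ∈ U, fderiv ℝ (fun y => mink (f y) (n y)) y ≠ 0 →
      ∀ Y, fderiv ℝ f y Y = Q y → fderiv ℝ n y Y = 0 := by
    intro y hy hne Y hYQ
    obtain ⟨X, Y', k, hX, hY, hkX, hpos, hsym, l, hl⟩ := hprin y hy
    obtain rfl : Y' = Y := by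
      refine sub_eq_zero.mp (H.eq_zero_of_fderiv_eq_zero hy ?_)
      rw [map_sub, hY, hYQ, sub_self]
    -- On tangent vectors `dh = -k ⟨T, ·⟩`, so `k = 0` would make the support function stationary.
    have hk : k ≠ 0 := by
      rintro rfl
      refine hne (ContinuousLinearMap.ext fun w => ?_)
      rw [H.fderiv_support hy, ← H.mink_tangential_fderiv_normal hy, mink_comm]
      change mink _ (T y) = 0
      rw [hsym]; ring
    -- A kernel vector of `dn` has image orthogonal to `T` because `k ≠ 0`. The image is non-zero,
    -- hence not orthogonal to `Q` as well, which forces the eigenvalue `l` along `Q` to vanish.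
    obtain ⟨v, hv0, hv⟩ := hker y hy
    have h1 : mink (fderiv ℝ f y v) (T y) = 0 := by
      have := hsym v
      rw [hv, mink_zero_left] at this
      simpa [hk] using this
    have h2 : l * mink (Q y) (fderiv ℝ f y v) = 0 := by
      have := H.shape_symm hy Y' v
      rwa [hv, hl, mink_smul_left, mink_zero_left] at this
    rcases mul_eq_zero.mp h2 with h2 | h2
    · rw [hl, h2, zero_smul]
    · refine absurd (H.eq_zero_of_fderiv_eq_zero hy ?_) hv0
      refine eq_zero_of_mink_frame (v := T y) (w := n y) ((hQQ y hy).trans_ne hpos.ne') h1 ?_ ?_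
      · rw [mink_comm]; exact H.normal y hy v
      · rw [mink_comm]; exact h2
  have hcont : ContinuousAt (fderiv ℝ (fun y => mink (f y) (n y))) z :=
    ((((H.smooth z hz).mink (H.smooth_normal z hz)).fderiv_right (m := ∞) (by simp))).continuousAt
  have hev : ∀ᶠ y in nhds z, y ∈ U ∧ fderiv ℝ (fun y => mink (f y) (n y)) y ≠ 0 :=
    (H.isOpen.eventually_mem hz).and (hcont.eventually_ne hne)
  -- near `z` the derivative of the normal is everywhere orthogonal to `Q`
  have horth : ∀ v, ∀ᶠ y in nhds z, mink (fderiv ℝ n y v) (Q y) = 0 := by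
    intro v
    filter_upwards [hev] with y ⟨hy, hyne⟩
    obtain ⟨X, Y, k, hX, hY, -⟩ := hprin y hy
    rw [← hY, H.shape_symm hy, hzero y hy hyne Y hY, mink_zero_left]
  have hdQ : DifferentiableAt ℝ Q z := (hQsm z hz).differentiableAt (by simp)
  have hdT : DifferentiableAt ℝ T z := (hTsm z hz).differentiableAt (by simp)
  have hdiff : ∀ v w, mink (fderiv ℝ (fun y => fderiv ℝ n y v) z w) (Q z)
      + mink (fderiv ℝ n z v) (fderiv ℝ Q z w) = 0 := fun v w =>
    mink_fderiv_add_of_eventually_const (H.differentiableAt_fderiv_normal hz v) hdQ (horth v) w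
  obtain ⟨X, Y, k, hX, hY, hkX, hpos, hsym, -⟩ := hprin z hz
  have hnY := hzero z hz hne Y hY
  have hk : k ≠ 0 := by
    rintro rfl
    refine hne (ContinuousLinearMap.ext fun w => ?_)
    rw [H.fderiv_support hz, ← H.mink_tangential_fderiv_normal hz, mink_comm]
    change mink _ (T z) = 0
    rw [hsym]; ring
  have h1 := hdiff X Y
  have h2 := hdiff Y X
  -- The mixed second derivatives of `n` along `X` and `Y` agree, and `dn(Y) = 0`. The two
  -- identities then leave only `k ⟨T, dQ(Y)⟩ = 0`.
  rw [fderiv_fderiv_apply_comm (H.smooth_normal z hz) X Y] at h1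
  rw [hnY, mink_zero_left] at h2
  rw [hkX, mink_neg_left, mink_smul_left] at h1
  have h3 : mink (T z) (fderiv ℝ Q z Y) = 0 := by
    have : k * mink (T z) (fderiv ℝ Q z Y) = 0 := by linarith
    simpa [hk] using this
  have h4 := mink_fderiv_add_of_eventually_const hdT hdQ (c := 0)
    (Filter.Eventually.of_forall fun y => by rw [mink_comm]; exact mink_lcross_left _ _) Y
  -- `dT(Y) = df(Y) + dh(Y) n + h dn(Y)`, where the first term is `Q`, the second is normal and the
  -- third vanishes.
  have h5 : mink (fderiv ℝ T z Y) (Q z) = mink (Q z) (Q z) := by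
    have hdn := H.differentiableAt_normal hz
    have hdh := (H.differentiableAt hz).mink hdn
    have : fderiv ℝ T z Y = Q z + fderiv ℝ (fun y => mink (f y) (n y)) z Y • n z := by
      rw [hT, fderiv_fun_add (H.differentiableAt hz) (hdh.fun_smul hdn), fderiv_fun_smul hdh hdn]
      simp [hY, hnY]
    rw [this, mink_add_left, mink_smul_left, mink_comm (n z), mink_lcross_right]
    ring
  rw [h5, hQQ z hz] at h4
  linarith

end SpacelikePatch

/-! ### The Gauss equation -/

/-- The coordinate vector fields of the plane. -/
abbrev coordVec (i : Fin 2) : Plane := EuclideanSpace.single i 1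

theorem plane_eq_sum (w : Plane) : w = ∑ i, w i • coordVec i := by
  ext j
  fin_cases j <;> simp [Fin.sum_univ_two]

theorem map_plane_eq_sum {F : Type*} [NormedAddCommGroup F] [NormedSpace ℝ F] (L : Plane →L[ℝ] F)
    (w : Plane) : L w = w 0 • L (coordVec 0) + w 1 • L (coordVec 1) := by
  conv_lhs => rw [plane_eq_sum w]
  simp [Fin.sum_univ_two]

theorem mink_sum_left {ι : Type*} (s : Finset ι) (v : ι → E31) (w : E31) :
    mink (∑ i ∈ s, v i) w = ∑ i ∈ s, mink (v i) w := by
  induction s using Finset.cons_induction with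
  | empty => simp [mink_zero_left]
  | cons a s ha ih => rw [Finset.sum_cons, Finset.sum_cons, mink_add_left, ih]

theorem mink_sum_right {ι : Type*} (s : Finset ι) (v : ι → E31) (w : E31) :
    mink w (∑ i ∈ s, v i) = ∑ i ∈ s, mink w (v i) := by
  rw [mink_comm, mink_sum_left]
  exact Finset.sum_congr rfl fun i _ => mink_comm _ _

namespace SpacelikePatch

variable {f n : Plane → E31} {U : Set Plane} {z : Plane}

/-- A null vector of the Gram matrix would give a non-zero tangent vector of length zero. -/
theorem det_inducedMetric_ne_zero (H : SpacelikePatch f n U) (hz : z ∈ U) :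
    (inducedMetric f z).det ≠ 0 := by
  intro h0
  obtain ⟨v, hv, h⟩ := Matrix.exists_mulVec_eq_zero_iff.mpr h0
  have hw : WithLp.toLp 2 v ≠ (0 : Plane) := fun h => hv (by simpa using h)
  refine (H.pos z hz _ hw).ne' ?_
  have e0 := congrFun h 0
  have e1 := congrFun h 1
  simp only [inducedMetric, Matrix.mulVec, dotProduct, Fin.sum_univ_two, Matrix.of_apply,
    Pi.zero_apply] at e0 e1
  rw [map_plane_eq_sum]
  simp only [mink_add_left, mink_add_right, mink_smul_left, mink_smul_right]
  linear_combination v 0 * e0 + v 1 * e1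

theorem contDiffAt_inducedMetric (H : SpacelikePatch f n U) (hz : z ∈ U) (i j : Fin 2) :
    ContDiffAt ℝ ∞ (fun y => inducedMetric f y i j) z :=
  ((H.smooth z hz).fderiv_apply_const (F := E31) _).mink
    ((H.smooth z hz).fderiv_apply_const (F := E31) _)

theorem contDiffAt_inducedMetric_inv (H : SpacelikePatch f n U) (hz : z ∈ U) (i j : Fin 2) :
    ContDiffAt ℝ ∞ (fun y => (inducedMetric f y)⁻¹ i j) z := by
  have hg := H.contDiffAt_inducedMetric hz
  have hdet : ContDiffAt ℝ ∞ (fun y => (inducedMetric f y).det) z := by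
    simp only [Matrix.det_fin_two]
    exact ((hg 0 0).mul (hg 1 1)).sub ((hg 0 1).mul (hg 1 0))
  have hinv := hdet.inv (H.det_inducedMetric_ne_zero hz)
  simp only [Matrix.inv_def, Ring.inverse_eq_inv', Matrix.smul_apply, smul_eq_mul,
    Matrix.adjugate_fin_two]
  refine hinv.mul ?_
  fin_cases i <;> fin_cases j
  exacts [hg 1 1, (hg 0 1).neg, (hg 1 0).neg, hg 0 0]

theorem contDiffAt_christoffel (H : SpacelikePatch f n U) (hz : z ∈ U) (k i j : Fin 2) :
    ContDiffAt ℝ ∞ (christoffel (inducedMetric f) k i j) z := by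
  have hp : ∀ a b c, ContDiffAt ℝ ∞ (partialD a fun y => inducedMetric f y b c) z := fun a b c =>
    (H.contDiffAt_inducedMetric hz b c).fderiv_apply_const (F := ℝ) _
  exact contDiffAt_const.mul (ContDiffAt.sum fun l _ =>
    (H.contDiffAt_inducedMetric_inv hz k l).mul (((hp _ _ _).add (hp _ _ _)).sub (hp _ _ _)))

theorem partialD_inducedMetric (H : SpacelikePatch f n U) (hz : z ∈ U) (l i j : Fin 2) :
    partialD l (fun y => inducedMetric f y i j) z
      = mink (fderiv ℝ (fun y => fderiv ℝ f y (coordVec i)) z (coordVec l))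
          (fderiv ℝ f z (coordVec j))
        + mink (fderiv ℝ f z (coordVec i))
          (fderiv ℝ (fun y => fderiv ℝ f y (coordVec j)) z (coordVec l)) :=
  fderiv_mink (H.differentiableAt_fderiv hz _) (H.differentiableAt_fderiv hz _) _

/-- For an induced metric, symmetry of second derivatives cancels all but two equal terms in the
Christoffel bracket, leaving the tangential components of `∂ᵢ∂ⱼ f`. -/
theorem christoffel_eq (H : SpacelikePatch f n U) (hz : z ∈ U) (k i j : Fin 2) :
    christoffel (inducedMetric f) k i j z = ∑ l, (inducedMetric f z)⁻¹ k l *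
      mink (fderiv ℝ (fun y => fderiv ℝ f y (coordVec j)) z (coordVec i))
        (fderiv ℝ f z (coordVec l)) := by
  rw [christoffel, Finset.mul_sum]
  refine Finset.sum_congr rfl fun l _ => ?_
  rw [H.partialD_inducedMetric hz, H.partialD_inducedMetric hz, H.partialD_inducedMetric hz,
    fderiv_fderiv_apply_comm (H.smooth z hz) (coordVec i) (coordVec j),
    fderiv_fderiv_apply_comm (H.smooth z hz) (coordVec i) (coordVec l),
    fderiv_fderiv_apply_comm (H.smooth z hz) (coordVec j) (coordVec l),
    mink_comm (fderiv ℝ f z (coordVec i)),  mink_comm (fderiv ℝ f z (coordVec j))]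
  ring

/-- The Gauss formula for the second derivatives of a space-like patch. -/
theorem gauss_formula (H : SpacelikePatch f n U) (hz : z ∈ U) (i j : Fin 2) :
    fderiv ℝ (fun y => fderiv ℝ f y (coordVec j)) z (coordVec i)
      = ∑ k, christoffel (inducedMetric f) k i j z • fderiv ℝ f z (coordVec k)
        + mink (fderiv ℝ n z (coordVec i)) (fderiv ℝ f z (coordVec j)) • n z := by
  have hn := H.normal z hz
  refine sub_eq_zero.mp (H.eq_zero_of_mink_eq_zero hz ?_ fun w => ?_)
  · rw [mink_sub_right, mink_add_right, mink_smul_right, H.unit z hz,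
      mink_sum_right]
    simp only [mink_smul_right, hn]
    have := H.mink_normal_snd hz (coordVec i) (coordVec j)
    simp only [mul_zero, Finset.sum_const_zero]
    linarith
  · have key : ∀ m, mink (∑ k, christoffel (inducedMetric f) k i j z • fderiv ℝ f z (coordVec k))
        (fderiv ℝ f z (coordVec m))
        = mink (fderiv ℝ (fun y => fderiv ℝ f y (coordVec j)) z (coordVec i))
          (fderiv ℝ f z (coordVec m)) := by
      intro m
      rw [mink_sum_left]
      simp only [mink_smul_left, H.christoffel_eq hz]
      have hg : inducedMetric f z * (inducedMetric f z)⁻¹ = 1 :=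
        Matrix.mul_nonsing_inv _ (isUnit_iff_ne_zero.mpr (H.det_inducedMetric_ne_zero hz))
      have hgm := fun l => congrFun (congrFun hg m) l
      simp only [Matrix.mul_apply, Fin.sum_univ_two] at hgm ⊢
      have hsym : ∀ k, mink (fderiv ℝ f z (coordVec k)) (fderiv ℝ f z (coordVec m))
          = inducedMetric f z m k := fun k => mink_comm _ _
      rw [hsym, hsym]
      set V := fderiv ℝ (fun y => fderiv ℝ f y (coordVec j)) z (coordVec i)
      have e0 := hgm 0
      have e1 := hgm 1
      have hδ : ∑ l, (1 : Matrix (Fin 2) (Fin 2) ℝ) m l * mink V (fderiv ℝ f z (coordVec l))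
          = mink V (fderiv ℝ f z (coordVec m)) := by simp [Matrix.one_apply]
      rw [Fin.sum_univ_two] at hδ
      linear_combination mink V (fderiv ℝ f z (coordVec 0)) * e0
        + mink V (fderiv ℝ f z (coordVec 1)) * e1 + hδ
    rw [map_plane_eq_sum (fderiv ℝ f z) w, mink_add_right, mink_smul_right, mink_smul_right]
    simp only [mink_sub_left, mink_add_left, mink_smul_left, key, hn]
    ring

/-- The Gauss equation. -/
theorem gauss_equation (H : SpacelikePatch f n U) (hz : z ∈ U) (k i j : Fin 2) :
    ∑ l, riemann (inducedMetric f) l k i j z • fderiv ℝ f z (coordVec l)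
      = mink (fderiv ℝ n z (coordVec i)) (fderiv ℝ f z (coordVec k)) • fderiv ℝ n z (coordVec j)
        - mink (fderiv ℝ n z (coordVec j)) (fderiv ℝ f z (coordVec k)) •
          fderiv ℝ n z (coordVec i) := by
  have hΓ : ∀ a b c, DifferentiableAt ℝ (christoffel (inducedMetric f) a b c) z := fun a b c =>
    (H.contDiffAt_christoffel hz a b c).differentiableAt (by simp)
  have hb : ∀ a b, DifferentiableAt ℝ
      (fun y => mink (fderiv ℝ n y (coordVec a)) (fderiv ℝ f y (coordVec b))) z := fun a b =>
    (H.differentiableAt_fderiv_normal hz _).mink (H.differentiableAt_fderiv hz _)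
  have hdf := H.differentiableAt_fderiv hz
  have hdn := H.differentiableAt_normal hz
  -- the derivative of the Gauss formula
  have third : ∀ a b, ∃ c : ℝ,
      fderiv ℝ (fun y => fderiv ℝ (fun x => fderiv ℝ f x (coordVec k)) y (coordVec b)) z
        (coordVec a)
      = ∑ l, (partialD a (christoffel (inducedMetric f) l b k) z
          + ∑ m, christoffel (inducedMetric f) l a m z * christoffel (inducedMetric f) m b k z) •
            fderiv ℝ f z (coordVec l)
        + mink (fderiv ℝ n z (coordVec b)) (fderiv ℝ f z (coordVec k)) • fderiv ℝ n z (coordVec a)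
        + c • n z := by
    intro a b
    have hev : (fun y => fderiv ℝ (fun x => fderiv ℝ f x (coordVec k)) y (coordVec b)) =ᶠ[nhds z]
        fun y => (christoffel (inducedMetric f) 0 b k y • fderiv ℝ f y (coordVec 0)
          + christoffel (inducedMetric f) 1 b k y • fderiv ℝ f y (coordVec 1))
          + mink (fderiv ℝ n y (coordVec b)) (fderiv ℝ f y (coordVec k)) • n y := by
      filter_upwards [H.isOpen.mem_nhds hz] with y hy
      rw [H.gauss_formula hy, Fin.sum_univ_two]
    rw [hev.fderiv_eq, fderiv_fun_add (((hΓ _ _ _).fun_smul (hdf _)).fun_add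
        ((hΓ _ _ _).fun_smul (hdf _))) ((hb _ _).fun_smul hdn),
      fderiv_fun_add ((hΓ _ _ _).fun_smul (hdf _)) ((hΓ _ _ _).fun_smul (hdf _)),
      fderiv_fun_smul (hΓ _ _ _) (hdf _), fderiv_fun_smul (hΓ _ _ _) (hdf _),
      fderiv_fun_smul (hb _ _) hdn]
    simp only [add_apply, smul_apply,
      ContinuousLinearMap.smulRight_apply, H.gauss_formula hz, Fin.sum_univ_two, partialD]
    -- The normal coefficient matters only through its existence: it is eliminated below by pairing
    -- with `n`.
    refine ⟨christoffel (inducedMetric f) 0 b k z *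
        mink (fderiv ℝ n z (coordVec a)) (fderiv ℝ f z (coordVec 0))
      + christoffel (inducedMetric f) 1 b k z *
        mink (fderiv ℝ n z (coordVec a)) (fderiv ℝ f z (coordVec 1))
      + fderiv ℝ (fun y => mink (fderiv ℝ n y (coordVec b)) (fderiv ℝ f y (coordVec k))) z
        (coordVec a), ?_⟩
    module
  obtain ⟨c₁, h₁⟩ := third i j
  obtain ⟨c₂, h₂⟩ := third j i
  rw [fderiv_fderiv_apply_comm ((H.smooth z hz).fderiv_apply_const (F := E31) (coordVec k)), h₂]
    at h₁
  have hmain : ∑ l, riemann (inducedMetric f) l k i j z • fderiv ℝ f z (coordVec l)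
      = mink (fderiv ℝ n z (coordVec i)) (fderiv ℝ f z (coordVec k)) • fderiv ℝ n z (coordVec j)
        - mink (fderiv ℝ n z (coordVec j)) (fderiv ℝ f z (coordVec k)) •
          fderiv ℝ n z (coordVec i) + (c₂ - c₁) • n z := by
    simp only [riemann, Fin.sum_univ_two] at h₁ ⊢
    rw [← sub_eq_zero] at h₁ ⊢
    rw [← neg_eq_zero, ← h₁]
    module
  -- All other terms are tangent, so the normal components must cancel; this is the Codazzi
  -- equation.
  have hc : c₂ - c₁ = 0 := by
    have := congrArg (mink (n z)) hmain
    rw [mink_sum_right] at this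
    simp only [H.normal z hz, mink_add_right, mink_sub_right,
      mink_smul_right, H.mink_normal_fderiv_normal hz, H.unit z hz, mul_zero,
      Finset.sum_const_zero] at this
    linarith
  rw [hmain, hc, zero_smul, add_zero]

/-- A space-like patch has vanishing curvature where its normal is not an immersion. -/
theorem riemann_eq_zero (H : SpacelikePatch f n U) (hz : z ∈ U) {v : Plane} (hv : v ≠ 0)
    (hnv : fderiv ℝ n z v = 0) (l k i j : Fin 2) : riemann (inducedMetric f) l k i j z = 0 := by
  have hG := H.gauss_equation hz k i j
  have hdep := map_plane_eq_sum (fderiv ℝ n z) v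
  rw [hnv] at hdep
  have hrhs : mink (fderiv ℝ n z (coordVec i)) (fderiv ℝ f z (coordVec k)) •
      fderiv ℝ n z (coordVec j) - mink (fderiv ℝ n z (coordVec j)) (fderiv ℝ f z (coordVec k)) •
      fderiv ℝ n z (coordVec i) = 0 := by
    -- With a non-trivial kernel, `dn` has rank at most one. The right-hand side of the Gauss
    -- equation is antisymmetric in `i, j`, so it vanishes when both derivatives are multiples of
    -- one vector.
    obtain ⟨w, c, hc⟩ : ∃ (w : E31) (c : Fin 2 → ℝ),
        ∀ a, fderiv ℝ n z (coordVec a) = c a • w := by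
      by_cases h0 : v 0 = 0
      · have h1 : v 1 ≠ 0 := fun h1 => hv (by ext a; fin_cases a <;> simpa)
        refine ⟨fderiv ℝ n z (coordVec 0), ![1, 0], fun a => ?_⟩
        rw [h0, zero_smul, zero_add, eq_comm, smul_eq_zero_iff_right h1] at hdep
        fin_cases a
        · simp
        · simpa using hdep
      · refine ⟨fderiv ℝ n z (coordVec 1), ![-(v 1 / v 0), 1], fun a => ?_⟩
        fin_cases a
        · have := congrArg (fun y => (v 0)⁻¹ • y) hdep
          simp only [smul_zero, smul_add, smul_smul, inv_mul_cancel₀ h0, one_smul] at this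
          have h2 := eq_neg_of_add_eq_zero_left this.symm
          simp only [Fin.zero_eta, Matrix.cons_val_zero]
          rw [h2, ← neg_smul, div_eq_inv_mul]
        · simp
    rw [hc, hc, mink_smul_left, mink_smul_left]
    module
  rw [hrhs] at hG
  have hw : fderiv ℝ f z (WithLp.toLp 2 fun a => riemann (inducedMetric f) a k i j z) = 0 := by
    rw [map_plane_eq_sum, ← hG, Fin.sum_univ_two]
  have := congrArg (fun y : Plane => y l) (H.eq_zero_of_fderiv_eq_zero hz hw)
  simpa using this

/-- Where the curvature of a space-like patch vanishes, its normal is not an immersion. -/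
theorem exists_fderiv_normal_eq_zero (H : SpacelikePatch f n U) (hz : z ∈ U)
    (hflat : ∀ l k i j : Fin 2, riemann (inducedMetric f) l k i j z = 0) :
    ∃ v, v ≠ 0 ∧ fderiv ℝ n z v = 0 := by
  have hG : ∀ k, mink (fderiv ℝ n z (coordVec 0)) (fderiv ℝ f z (coordVec k)) •
      fderiv ℝ n z (coordVec 1) - mink (fderiv ℝ n z (coordVec 1)) (fderiv ℝ f z (coordVec k)) •
      fderiv ℝ n z (coordVec 0) = 0 := fun k => by
    rw [← H.gauss_equation hz k 0 1]
    simp [hflat]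
  by_cases h : ∀ a k, mink (fderiv ℝ n z (coordVec a)) (fderiv ℝ f z (coordVec k)) = 0
  · refine ⟨coordVec 0, by simp, ?_⟩
    refine H.eq_zero_of_mink_eq_zero hz (H.mink_normal_fderiv_normal hz _) fun w => ?_
    rw [map_plane_eq_sum (fderiv ℝ f z) w, mink_add_right, mink_smul_right, mink_smul_right, h, h]
    ring
  · push Not at h
    obtain ⟨a, k, hak⟩ := h
    -- The Gauss equation with `i = 0`, `j = 1` is itself a linear relation between `∂₀ n` and `∂₁
    -- n`; its coefficients form the kernel vector, non-zero for this choice of `k`.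
    refine ⟨!₂[-mink (fderiv ℝ n z (coordVec 1)) (fderiv ℝ f z (coordVec k)),
      mink (fderiv ℝ n z (coordVec 0)) (fderiv ℝ f z (coordVec k))], fun h0 => hak ?_, ?_⟩
    · have e0 := congrArg (fun y : Plane => y 0) h0
      have e1 := congrArg (fun y : Plane => y 1) h0
      simp at e0 e1
      fin_cases a
      · exact e1
      · exact e0
    · rw [map_plane_eq_sum, ← hG k]
      simp only [Matrix.cons_val_zero, Matrix.cons_val_one]
      module

end SpacelikePatch

/-! ### Inverse functions and functional dependence -/

/-- The inverse function theorem for smooth self-maps of a finite-dimensional space. -/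
theorem exists_openPartialHomeomorph_of_fderiv_injective {E : Type*} [NormedAddCommGroup E]
    [NormedSpace ℝ E] [FiniteDimensional ℝ E] {G : E → E} {U : Set E} {z₀ : E} (hU : IsOpen U)
    (hz₀ : z₀ ∈ U) (hG : ∀ z ∈ U, ContDiffAt ℝ ∞ G z) (hinj : ∀ w, fderiv ℝ G z₀ w = 0 → w = 0) :
    ∃ g : OpenPartialHomeomorph E E, z₀ ∈ g.source ∧ g.source ⊆ U ∧ ⇑g = G ∧
      (∀ y ∈ g.target, ContDiffAt ℝ ∞ g.symm y) ∧
      ∀ z ∈ g.source, ∀ w, fderiv ℝ G z w = 0 → w = 0 := by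
  have : CompleteSpace E := FiniteDimensional.complete ℝ E
  have hdiff : ∀ z ∈ U, HasFDerivAt G (fderiv ℝ G z) z := fun z hz =>
    ((hG z hz).differentiableAt (by simp)).hasFDerivAt
  have hunit : IsUnit (fderiv ℝ G z₀) := by
    have hk : LinearMap.ker (fderiv ℝ G z₀ : E →ₗ[ℝ] E) = ⊥ :=
      (LinearMap.ker_eq_bot').mpr hinj
    let L := (LinearEquiv.ofInjectiveEndo (fderiv ℝ G z₀ : E →ₗ[ℝ] E)
      (LinearMap.ker_eq_bot.mp hk)).toContinuousLinearEquiv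
    have : fderiv ℝ G z₀ = (ContinuousLinearEquiv.unitsEquiv ℝ E).symm L := by
      ext w; rfl
    rw [this]
    exact Units.isUnit _
  have hcont : ContinuousAt (fderiv ℝ G) z₀ :=
    ((hG z₀ hz₀).fderiv_right (m := ∞) (by simp)).continuousAt
  -- Invertible operators form an open set, so the differential stays invertible near `z₀`. This
  -- makes the inverse smooth on the whole target rather than only at the image of `z₀`.
  obtain ⟨V, hVsub, hV, hzV⟩ := mem_nhds_iff.mp
    (Filter.inter_mem (hU.mem_nhds hz₀) (hcont (Units.isOpen.mem_nhds hunit)))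
  obtain ⟨u, hu⟩ := hunit
  have h₀ : HasFDerivAt G (ContinuousLinearEquiv.unitsEquiv ℝ E u : E →L[ℝ] E) z₀ := by
    have : (ContinuousLinearEquiv.unitsEquiv ℝ E u : E →L[ℝ] E) = fderiv ℝ G z₀ := by
      rw [← hu]; ext w; rfl
    rw [this]; exact hdiff z₀ hz₀
  let g₀ := (hG z₀ hz₀).toOpenPartialHomeomorph G h₀ (by simp)
  have hs : (g₀.restrOpen V hV).source = g₀.source ∩ V := rfl
  refine ⟨g₀.restrOpen V hV, ?_, ?_, rfl, ?_, ?_⟩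
  · rw [hs]
    exact ⟨(hG z₀ hz₀).mem_toOpenPartialHomeomorph_source h₀ (by simp), hzV⟩
  · rw [hs]
    exact fun z hz => (hVsub hz.2).1
  · intro y hy
    have hmem := (g₀.restrOpen V hV).map_target hy
    rw [hs] at hmem
    obtain ⟨hyU, v, hv⟩ := hVsub hmem.2
    have h₁ : HasFDerivAt G (ContinuousLinearEquiv.unitsEquiv ℝ E v : E →L[ℝ] E)
        ((g₀.restrOpen V hV).symm y) := by
      have : (ContinuousLinearEquiv.unitsEquiv ℝ E v : E →L[ℝ] E)
          = fderiv ℝ G ((g₀.restrOpen V hV).symm y) := by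
        rw [← hv]; ext w; rfl
      rw [this]; exact hdiff _ hyU
    exact (g₀.restrOpen V hV).contDiffAt_symm hy h₁ (hG _ hyU)
  · intro z hz w hw
    rw [hs] at hz
    obtain ⟨v, hv⟩ := (hVsub hz.2).2
    have : (↑v⁻¹ * ↑v : E →L[ℝ] E) w = 0 := by
      change (↑v⁻¹ : E →L[ℝ] E) ((v : E →L[ℝ] E) w) = 0
      rw [hv, hw, map_zero]
    simpa using this

/-- The point of the plane with coordinates `a` and `b`. -/
def planePt (a b : ℝ) : Plane := a • coordVec 0 + b • coordVec 1

@[simp] theorem planePt_zero (a b : ℝ) : planePt a b 0 = a := by simp [planePt]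

@[simp] theorem planePt_one (a b : ℝ) : planePt a b 1 = b := by simp [planePt]

theorem ContDiffAt.planePt {s τ : Plane → ℝ} {z : Plane} (hs : ContDiffAt ℝ ∞ s z)
    (hτ : ContDiffAt ℝ ∞ τ z) : ContDiffAt ℝ ∞ (fun y => planePt (s y) (τ y)) z :=
  (hs.smul contDiffAt_const).add (hτ.smul contDiffAt_const)

theorem fderiv_planePt {s τ : Plane → ℝ} {z : Plane} (hs : DifferentiableAt ℝ s z)
    (hτ : DifferentiableAt ℝ τ z) (w : Plane) :
    fderiv ℝ (fun y => planePt (s y) (τ y)) z w = planePt (fderiv ℝ s z w) (fderiv ℝ τ z w) := by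
  have := ((hs.hasFDerivAt.smul_const (coordVec 0)).add
    (hτ.hasFDerivAt.smul_const (coordVec 1))).fderiv
  simp only [planePt]
  rw [show (fun y => s y • coordVec 0 + τ y • coordVec 1)
    = ((fun y => s y • coordVec 0) + fun y => τ y • coordVec 1) from rfl, this]
  simp

/-- Near `z₀`, functions whose derivative vanishes on the (one-dimensional) kernel of `dτ` are
functions of `τ`. -/
theorem exists_section {s τ : Plane → ℝ} {V : Set Plane} {z₀ : Plane} (hV : IsOpen V)
    (hz₀ : z₀ ∈ V) (hs : ∀ z ∈ V, ContDiffAt ℝ ∞ s z) (hτ : ∀ z ∈ V, ContDiffAt ℝ ∞ τ z)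
    (hinj : ∀ w, fderiv ℝ s z₀ w = 0 → fderiv ℝ τ z₀ w = 0 → w = 0) :
    ∃ (γ : ℝ → Plane) (ε : ℝ) (V' : Set Plane), 0 < ε ∧ IsOpen V' ∧ z₀ ∈ V' ∧ V' ⊆ V ∧
      γ (τ z₀) = z₀ ∧
      (∀ t ∈ Metric.ball (τ z₀) ε, γ t ∈ V ∧ ContDiffAt ℝ ∞ γ t ∧ τ (γ t) = t) ∧
      ∀ z ∈ V', τ z ∈ Metric.ball (τ z₀) ε ∧
        ∀ P : Plane → E31, (∀ y ∈ V, DifferentiableAt ℝ P y ∧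
          ∃ X, fderiv ℝ s y X ≠ 0 ∧ fderiv ℝ τ y X = 0 ∧ fderiv ℝ P y X = 0) →
          P z = P (γ (τ z)) := by
  have hsd : ∀ z ∈ V, DifferentiableAt ℝ s z := fun z hz => (hs z hz).differentiableAt (by simp)
  have hτd : ∀ z ∈ V, DifferentiableAt ℝ τ z := fun z hz => (hτ z hz).differentiableAt (by simp)
  obtain ⟨g, hg₀, hgV, hgF, hgs, hginj⟩ := exists_openPartialHomeomorph_of_fderiv_injective
    (G := fun y => planePt (s y) (τ y)) hV hz₀ (fun z hz => (hs z hz).planePt (hτ z hz))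
    (fun w hw => by
      rw [fderiv_planePt (hsd _ hz₀) (hτd _ hz₀)] at hw
      refine hinj w ?_ ?_
      · rw [← planePt_zero (fderiv ℝ s z₀ w) (fderiv ℝ τ z₀ w), hw]; rfl
      · rw [← planePt_one (fderiv ℝ s z₀ w) (fderiv ℝ τ z₀ w), hw]; rfl)
  have hg : ∀ z, g z = planePt (s z) (τ z) := fun z => congrFun hgF z
  -- a box in the target
  have hcont : Continuous fun q : ℝ × ℝ => planePt q.1 q.2 := by unfold planePt; fun_prop
  have hbox : (fun q : ℝ × ℝ => planePt q.1 q.2) ⁻¹' g.target ∈ nhds (s z₀, τ z₀) :=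
    hcont.continuousAt.preimage_mem_nhds (g.open_target.mem_nhds (by
      simpa [hg] using g.map_source hg₀))
  obtain ⟨ε, hε, hball⟩ := Metric.mem_nhds_iff.mp hbox
  have htarget : ∀ a ∈ Metric.ball (s z₀) ε, ∀ b ∈ Metric.ball (τ z₀) ε,
      planePt a b ∈ g.target := fun a ha b hb =>
    hball (show (a, b) ∈ Metric.ball (s z₀, τ z₀) ε by
      rw [← ball_prod_same]; exact ⟨ha, hb⟩)
  have hsc : ContinuousOn s g.source := fun z hz => (hsd z (hgV hz)).continuousAt.continuousWithinAt
  have hτc : ContinuousOn τ g.source := fun z hz => (hτd z (hgV hz)).continuousAt.continuousWithinAt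
  -- In the coordinates `(s, τ)` the section `γ` is the line `s = s(z₀)`.
  refine ⟨fun t => g.symm (planePt (s z₀) t), ε,
    g.source ∩ s ⁻¹' Metric.ball (s z₀) ε ∩ τ ⁻¹' Metric.ball (τ z₀) ε, hε, ?_, ?_, ?_, ?_, ?_, ?_⟩
  · rw [Set.inter_assoc, Set.inter_inter_distrib_left]
    exact (hsc.isOpen_inter_preimage g.open_source Metric.isOpen_ball).inter
      (hτc.isOpen_inter_preimage g.open_source Metric.isOpen_ball)
  · exact ⟨⟨hg₀, Metric.mem_ball_self hε⟩, Metric.mem_ball_self hε⟩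
  · exact fun z hz => hgV hz.1.1
  · simp only
    rw [← hg, g.left_inv hg₀]
  · intro t ht
    have hmem := htarget _ (Metric.mem_ball_self hε) t ht
    refine ⟨hgV (g.map_target hmem), ?_, ?_⟩
    · refine (hgs _ hmem).comp t (f := fun t => planePt (s z₀) t) ?_
      unfold planePt; fun_prop
    · have := congrArg (fun y : Plane => y 1) (g.right_inv hmem)
      simpa [hg] using this
  · rintro z ⟨⟨hz, hzs⟩, hzτ⟩
    refine ⟨hzτ, fun P hP => ?_⟩
    have hder : ∀ a ∈ Metric.ball (s z₀) ε,
        HasDerivAt (fun a => P (g.symm (planePt a (τ z)))) 0 a := by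
      intro a ha
      have hmem := htarget a ha _ hzτ
      have hyV := hgV (g.map_target hmem)
      obtain ⟨hPd, X, hX₁, hX₂, hX₃⟩ := hP _ hyV
      have hline : HasDerivAt (fun a => planePt a (τ z)) (coordVec 0) a := by
        have := ((hasDerivAt_id a).smul_const (coordVec 0)).add_const (τ z • coordVec 1)
        simpa [planePt] using this
      have hsymm := ((hgs _ hmem).differentiableAt (by simp)).hasFDerivAt
      have hcurve := hsymm.comp_hasDerivAt a hline
      set Y := fderiv ℝ g.symm (planePt a (τ z)) (coordVec 0) with hY
      have hYτ : fderiv ℝ τ (g.symm (planePt a (τ z))) Y = 0 := by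
        have h1 := (hτd _ hyV).hasFDerivAt.comp_hasDerivAt a hcurve
        have h2 : (fun a => τ (g.symm (planePt a (τ z)))) =ᶠ[nhds a] fun _ => τ z := by
          filter_upwards [Metric.isOpen_ball.mem_nhds ha] with b hb
          have := congrArg (fun y : Plane => y 1) (g.right_inv (htarget b hb _ hzτ))
          simpa [hg] using this
        exact h1.unique ((hasDerivAt_const a (τ z)).congr_of_eventuallyEq h2)
      -- `Y` is the velocity of a coordinate line of constant `τ`. Since `(ds, dτ)` is injective,
      -- `ker dτ` is spanned by `X`, so `dP(Y) = 0` and `P` is constant along the line.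
      have hYX : Y = (fderiv ℝ s (g.symm (planePt a (τ z))) Y /
          fderiv ℝ s (g.symm (planePt a (τ z))) X) • X := by
        refine sub_eq_zero.mp (hginj _ (g.map_target hmem) _ ?_)
        rw [fderiv_planePt (hsd _ hyV) (hτd _ hyV)]
        simp only [map_sub, map_smul, smul_eq_mul, hYτ, hX₂, div_mul_cancel₀ _ hX₁]
        simp [planePt]
      have := hPd.hasFDerivAt.comp_hasDerivAt a hcurve
      rwa [hYX, map_smul, hX₃, smul_zero] at this
    have hconst := Metric.isOpen_ball.is_const_of_deriv_eq_zero
      (convex_ball (s z₀) ε).isPreconnected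
      (fun a ha => (hder a ha).differentiableAt.differentiableWithinAt)
      (fun a ha => (hder a ha).deriv) hzs (Metric.mem_ball_self hε)
    rwa [← hg, g.left_inv hz] at hconst

/-- A smooth function on an open interval has a smooth primitive. -/
theorem exists_smooth_primitive {l : ℝ → ℝ} {t₀ ε : ℝ}
    (hl : ∀ t ∈ Metric.ball t₀ ε, ContDiffAt ℝ ∞ l t) :
    ∃ A : ℝ → ℝ, (∀ t ∈ Metric.ball t₀ ε, ContDiffAt ℝ ∞ A t) ∧
      ∀ t ∈ Metric.ball t₀ ε, HasDerivAt A (l t) t := by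
  have hder : ∀ t ∈ Metric.ball t₀ ε, HasDerivAt (fun t => ∫ x in t₀..t, l x) (l t) t := by
    intro t ht
    have hε : 0 < ε := (dist_nonneg).trans_lt ht
    have hcon : ContinuousOn l (Metric.ball t₀ ε) := fun x hx =>
      (hl x hx).continuousAt.continuousWithinAt
    have hsub : Set.uIcc t₀ t ⊆ Metric.ball t₀ ε := by
      rw [← segment_eq_uIcc]
      exact (convex_ball t₀ ε).segment_subset (Metric.mem_ball_self hε) ht
    exact intervalIntegral.integral_hasDerivAt_right ((hcon.mono hsub).intervalIntegrable)
      (hcon.stronglyMeasurableAtFilter Metric.isOpen_ball t ht) (hl t ht).continuousAt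
  have hsm : ContDiffOn ℝ ∞ (fun t => ∫ x in t₀..t, l x) (Metric.ball t₀ ε) := by
    rw [contDiffOn_infty_iff_deriv_of_isOpen Metric.isOpen_ball]
    refine ⟨fun t ht => (hder t ht).differentiableAt.differentiableWithinAt, ?_⟩
    exact ContDiffOn.congr (fun t ht => (hl t ht).contDiffWithinAt) fun t ht => (hder t ht).deriv
  exact ⟨_, fun t ht => hsm.contDiffAt (Metric.isOpen_ball.mem_nhds ht), hder⟩

/-! ### Patches with constant support function -/

namespace SpacelikePatch

variable {f n : Plane → E31} {U : Set Plane}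

/-- A patch with constant support function `h` is ruled: `f = r e - h n` with `e` and `n` constant
along the rulings. -/
theorem exists_ruling {h : ℝ} (H : SpacelikePatch f n U)
    (hh : ∀ z ∈ U, mink (f z) (n z) = h)
    (hT : ∀ z ∈ U, ∃ X, X ≠ 0 ∧ fderiv ℝ f z X = f z + h • n z) :
    ∃ (r : Plane → ℝ) (e : Plane → E31), ∀ z ∈ U, ContDiffAt ℝ ∞ r z ∧ ContDiffAt ℝ ∞ e z ∧
      0 < r z ∧ r z ^ 2 = mink (f z) (f z) + h ^ 2 ∧ f z = r z • e z - h • n z ∧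
      mink (e z) (e z) = 1 ∧ mink (e z) (n z) = 0 ∧
      (∀ w, mink (fderiv ℝ e z w) (n z) = 0) ∧ (∀ w, mink (fderiv ℝ n z w) (e z) = 0) ∧
      (∀ w, r z * fderiv ℝ r z w = mink (f z) (fderiv ℝ f z w)) ∧
      ∃ X, fderiv ℝ f z X = r z • e z ∧ fderiv ℝ e z X = 0 ∧ fderiv ℝ n z X = 0 := by
  set ρ : Plane → ℝ := fun z => mink (f z) (f z) + h ^ 2 with hρ
  have hTT : ∀ z ∈ U, mink (f z + h • n z) (f z + h • n z) = ρ z := by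
    intro z hz
    simp only [mink_add_left, mink_add_right, mink_smul_left, mink_smul_right, H.unit z hz,
      mink_comm (n z) (f z), hh z hz, hρ]
    ring
  have hpos : ∀ z ∈ U, 0 < ρ z := by
    intro z hz
    obtain ⟨X, hX0, hX⟩ := hT z hz
    rw [← hTT z hz, ← hX]
    exact H.pos z hz X hX0
  set r : Plane → ℝ := fun z => √(ρ z) with hr
  have hrpos : ∀ z ∈ U, 0 < r z := fun z hz => Real.sqrt_pos.mpr (hpos z hz)
  have hrsq : ∀ z ∈ U, r z ^ 2 = ρ z := fun z hz => Real.sq_sqrt (hpos z hz).le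
  have hρs : ∀ z ∈ U, ContDiffAt ℝ ∞ ρ z := fun z hz =>
    ((H.smooth z hz).mink (H.smooth z hz)).add contDiffAt_const
  have hrs : ∀ z ∈ U, ContDiffAt ℝ ∞ r z := fun z hz => (hρs z hz).sqrt (hpos z hz).ne'
  set e : Plane → E31 := fun z => (r z)⁻¹ • (f z + h • n z) with he
  have hes : ∀ z ∈ U, ContDiffAt ℝ ∞ e z := fun z hz =>
    ((hrs z hz).inv (hrpos z hz).ne').smul
      ((H.smooth z hz).add ((H.smooth_normal z hz).const_smul h))
  have hre : ∀ z ∈ U, r z • e z = f z + h • n z := fun z hz => by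
    rw [he, smul_inv_smul₀ (hrpos z hz).ne']
  have hen : ∀ z ∈ U, mink (e z) (n z) = 0 := fun z hz => by
    simp only [he, mink_smul_left, mink_add_left, hh z hz, H.unit z hz]
    ring
  have hhz : ∀ z ∈ U, fderiv ℝ (fun y => mink (f y) (n y)) z = 0 := fun z hz => by
    have : (fun y => mink (f y) (n y)) =ᶠ[nhds z] fun _ => h := by
      filter_upwards [H.isOpen.mem_nhds hz] with y hy using hh y hy
    rw [this.fderiv_eq]
    simp
  -- `r ⟨dn w, e⟩ = ⟨dn w, f⟩ + h ⟨dn w, n⟩`, where the first term is `dh(w) = 0` and the second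
  -- vanishes because `n` has constant length.
  have hne : ∀ z ∈ U, ∀ w, mink (fderiv ℝ n z w) (e z) = 0 := fun z hz w => by
    have := H.fderiv_support hz w
    rw [hhz z hz] at this
    simp only [he, mink_smul_right, mink_add_right]
    rw [mink_comm _ (f z), ← this, mink_comm _ (n z), H.mink_normal_fderiv_normal hz]
    simp
  have hdr : ∀ z ∈ U, ∀ w, r z * fderiv ℝ r z w = mink (f z) (fderiv ℝ f z w) := fun z hz w => by
    have hd := (hrs z hz).differentiableAt (by simp)
    have h1 : fderiv ℝ (fun y => r y * r y) z w = fderiv ℝ ρ z w := by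
      rw [Filter.EventuallyEq.fderiv_eq (f := ρ)]
      filter_upwards [H.isOpen.mem_nhds hz] with y hy
      rw [← hrsq y hy, sq]
    rw [fderiv_fun_mul hd hd, hρ, fderiv_add_const,
      fderiv_mink (H.differentiableAt hz) (H.differentiableAt hz)] at h1
    simp only [add_apply, smul_apply, smul_eq_mul, mink_comm _ (f z)] at h1
    linarith
  refine ⟨r, e, fun z hz => ⟨hrs z hz, hes z hz, hrpos z hz, hrsq z hz, ?_, ?_, hen z hz, ?_,
    hne z hz, hdr z hz, ?_⟩⟩
  · rw [hre z hz, add_sub_cancel_right]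
  · simp only [he, mink_smul_left, mink_smul_right, hTT z hz, ← hrsq z hz]
    field_simp [(hrpos z hz).ne']
  · intro w
    have := mink_fderiv_add_of_eventually_const (c := 0) ((hes z hz).differentiableAt (by simp))
      (H.differentiableAt_normal hz)
      (Filter.eventually_of_mem (H.isOpen.mem_nhds hz) fun y hy => hen y hy) w
    rw [mink_comm (e z), hne z hz] at this
    linarith
  · obtain ⟨X, hX0, hX⟩ := hT z hz
    have hnX : fderiv ℝ n z X = 0 := H.fderiv_normal_eq_zero hz (hhz z hz) (by rw [hX, hh z hz])
    refine ⟨X, by rw [hX, hre z hz], ?_, hnX⟩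
    have hrX : fderiv ℝ r z X = r z := by
      have h1 := hdr z hz X
      have h2 : mink (f z) (f z + h • n z) = r z ^ 2 := by
        rw [mink_add_right, mink_smul_right, hh z hz, hrsq z hz, hρ]
        ring
      rw [hX, h2, sq] at h1
      exact mul_left_cancel₀ (hrpos z hz).ne' h1
    -- Differentiating `r e = f + h n` along `X` gives `r e + r de(X) = df(X) = r e`, hence `de(X) =
    -- 0`.
    have h1 : fderiv ℝ (fun y => r y • e y) z X = fderiv ℝ (fun y => f y + h • n y) z X := by
      rw [Filter.EventuallyEq.fderiv_eq]
      filter_upwards [H.isOpen.mem_nhds hz] with y hy using hre y hy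
    rw [fderiv_fun_smul ((hrs z hz).differentiableAt (by simp))
        ((hes z hz).differentiableAt (by simp)),
      fderiv_fun_add (H.differentiableAt hz) ((H.differentiableAt_normal hz).fun_const_smul h),
      fderiv_fun_const_smul (H.differentiableAt_normal hz)] at h1
    simp only [add_apply, smul_apply, ContinuousLinearMap.smulRight_apply, hX, hrX, hnX, hre z hz,
      smul_zero, add_zero] at h1
    exact (smul_eq_zero_iff_right (hrpos z hz).ne').mp (by simpa using h1)

/-- The frame adapted to the normal form of a patch with constant support function. -/
theorem exists_gcr_frame {h : ℝ} {z₀ : Plane} (H : SpacelikePatch f n U) (hz₀ : z₀ ∈ U)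
    (hh : ∀ z ∈ U, mink (f z) (n z) = h) (hcone : ∀ z ∈ U, mink (f z) (f z) < 0)
    (hT : ∀ z ∈ U, ∃ X, X ≠ 0 ∧ fderiv ℝ f z X = f z + h • n z) :
    ∃ (c₁ c₂ σ : ℝ) (s : Plane → ℝ) (P Q : Plane → E31), σ ^ 2 = 1 ∧
      (∀ w, fderiv ℝ s z₀ w = 0 →
        mink (fderiv ℝ P z₀ w) (lcross (P z₀) (Q z₀)) = 0 → w = 0) ∧
      ∀ z ∈ U, ContDiffAt ℝ ∞ s z ∧ ContDiffAt ℝ ∞ P z ∧ ContDiffAt ℝ ∞ Q z ∧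
        0 < s z ∧ s z < c₂ ∧ mink (P z) (P z) = -1 ∧ mink (Q z) (Q z) = 1 ∧
        mink (P z) (Q z) = 0 ∧ (∀ w, mink (fderiv ℝ P z w) (Q z) = 0) ∧
        f z = s z • (Real.cosh (c₁ - Real.arcosh (c₂ / s z)) • P z
          + Real.sinh (c₁ - Real.arcosh (c₂ / s z)) • σ • Q z) ∧
        ∃ X, fderiv ℝ s z X ≠ 0 ∧ fderiv ℝ P z X = 0 ∧ fderiv ℝ Q z X = 0 := by
  obtain ⟨r, e, hre⟩ := H.exists_ruling hh hT
  set s : Plane → ℝ := fun z => √(-mink (f z) (f z)) with hs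
  have hspos : ∀ z ∈ U, 0 < s z := fun z hz => Real.sqrt_pos.mpr (by linarith [hcone z hz])
  have hssq : ∀ z ∈ U, s z ^ 2 = -mink (f z) (f z) := fun z hz =>
    Real.sq_sqrt (by linarith [hcone z hz])
  have hsr : ∀ z ∈ U, s z ^ 2 + r z ^ 2 = h ^ 2 := fun z hz => by
    obtain ⟨-, -, -, h1, -⟩ := hre z hz
    rw [h1, hssq z hz]; ring
  have hss : ∀ z ∈ U, ContDiffAt ℝ ∞ s z := fun z hz =>
    ((H.smooth z hz).mink (H.smooth z hz)).neg.sqrt (by linarith [hcone z hz])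
  have hslt : ∀ z ∈ U, s z < |h| := fun z hz => by
    obtain ⟨-, -, h0, -⟩ := hre z hz
    refine lt_of_pow_lt_pow_left₀ 2 (abs_nonneg h) ?_
    rw [sq_abs, ← hsr z hz]
    nlinarith
  have hds : ∀ z ∈ U, ∀ w, s z * fderiv ℝ s z w = -mink (f z) (fderiv ℝ f z w) := fun z hz w => by
    have hd := (hss z hz).differentiableAt (by simp)
    have h1 : fderiv ℝ (fun y => s y * s y) z w = fderiv ℝ (fun y => -mink (f y) (f y)) z w := by
      rw [Filter.EventuallyEq.fderiv_eq (f := fun y => -mink (f y) (f y))]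
      filter_upwards [H.isOpen.mem_nhds hz] with y hy
      rw [← hssq y hy, sq]
    rw [fderiv_fun_mul hd hd, fderiv_fun_neg, neg_apply,
      fderiv_mink (H.differentiableAt hz) (H.differentiableAt hz)] at h1
    simp only [add_apply, smul_apply, smul_eq_mul, mink_comm _ (f z)] at h1
    linarith
  have habs : 0 < |h| := (hspos z₀ hz₀).trans (hslt z₀ hz₀)
  have hh0 : h ≠ 0 := abs_pos.mp habs
  set s₀ := s z₀ with hs₀
  set r₀ := r z₀ with hr₀
  have hs₀pos : 0 < s₀ := hspos z₀ hz₀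
  have hr₀pos : 0 < r₀ := (hre z₀ hz₀).2.2.1
  have hsr₀ : s₀ ^ 2 + r₀ ^ 2 = h ^ 2 := hsr z₀ hz₀
  -- The coefficients are frozen at their values at `z₀`: `P` and `Q` thus stay constant along the
  -- rulings, and `f(z₀) = s₀ P(z₀)`.
  set P : Plane → E31 := fun z => (r₀ / s₀) • e z - (h / s₀) • n z with hP
  set Q : Plane → E31 := fun z => (r₀ / s₀) • n z - (h / s₀) • e z with hQ
  have hed : ∀ z ∈ U, DifferentiableAt ℝ e z := fun z hz =>
    (hre z hz).2.1.differentiableAt (by simp)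
  have hdP : ∀ z ∈ U, ∀ w, fderiv ℝ P z w
      = (r₀ / s₀) • fderiv ℝ e z w - (h / s₀) • fderiv ℝ n z w := fun z hz w => by
    rw [hP, fderiv_fun_sub ((hed z hz).fun_const_smul _) ((H.differentiableAt_normal hz).fun_const_smul _),
      fderiv_fun_const_smul (hed z hz), fderiv_fun_const_smul (H.differentiableAt_normal hz)]
    rfl
  have hdQ : ∀ z ∈ U, ∀ w, fderiv ℝ Q z w
      = (r₀ / s₀) • fderiv ℝ n z w - (h / s₀) • fderiv ℝ e z w := fun z hz w => by
    rw [hQ, fderiv_fun_sub ((H.differentiableAt_normal hz).fun_const_smul _) ((hed z hz).fun_const_smul _),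
      fderiv_fun_const_smul (hed z hz), fderiv_fun_const_smul (H.differentiableAt_normal hz)]
    rfl
  have hcosh : ∀ z ∈ U, Real.cosh (Real.arcosh (|h| / s z)) = |h| / s z ∧
      Real.sinh (Real.arcosh (|h| / s z)) = r z / s z := fun z hz => by
    have h1 : 1 ≤ |h| / s z := by
      rw [le_div_iff₀ (hspos z hz), one_mul]; exact (hslt z hz).le
    refine ⟨Real.cosh_arcosh h1, ?_⟩
    rw [Real.sinh_arcosh h1, div_pow, sq_abs, ← hsr z hz]
    have : (s z ^ 2 + r z ^ 2) / s z ^ 2 - 1 = (r z / s z) ^ 2 := by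
      have := (hspos z hz).ne'
      field_simp
      ring
    rw [this, Real.sqrt_sq (div_nonneg (hre z hz).2.2.1.le (hspos z hz).le)]
  -- With `cosh θ = |h| / s` and `sinh θ = r / s`, passing from `z₀` to `z` rotates by `u = θ(z₀) -
  -- θ(z)`. The sign `σ` of `h` lets `c₂ = |h|` be positive.
  refine ⟨Real.arcosh (|h| / s₀), |h|, |h| / h, s, P, Q, ?_, ?_, ?_⟩
  · rw [div_pow, sq_abs, div_self (pow_ne_zero 2 hh0)]
  · intro w hw₁ hw₂
    obtain ⟨-, -, -, -, hf, hee, hen, hden, hdne, hdr, -⟩ := hre z₀ hz₀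
    have hfw : mink (f z₀) (fderiv ℝ f z₀ w) = 0 := by
      have := hds z₀ hz₀ w
      rw [hw₁] at this
      linarith
    have hrw : fderiv ℝ r z₀ w = 0 := by
      have := hdr w
      rw [hfw] at this
      exact (mul_eq_zero.mp this).resolve_left hr₀pos.ne'
    have hfe : f z₀ = s₀ • P z₀ := by
      rw [hf, hP]
      simp only [smul_sub, smul_smul, mul_div_cancel₀ _ hs₀pos.ne']
      rfl
    -- At `z₀` the frozen coefficients are the true ones, so for `ds(w) = 0` (hence `dr(w) = 0`) the
    -- differentials of `f` and `s₀ P` agree on `w`. As `dP` is orthogonal to `P` and `Q`, only its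
    -- component along `P ∧ Q` remains to be tested.
    have hdf : fderiv ℝ f z₀ w = s₀ • fderiv ℝ P z₀ w := by
      have h1 : fderiv ℝ f z₀ w = fderiv ℝ (fun y => r y • e y - h • n y) z₀ w := by
        rw [Filter.EventuallyEq.fderiv_eq]
        filter_upwards [H.isOpen.mem_nhds hz₀] with y hy using (hre y hy).2.2.2.2.1
      have hrd : DifferentiableAt ℝ r z₀ := (hre z₀ hz₀).1.differentiableAt (by simp)
      rw [h1, fderiv_fun_sub (hrd.fun_smul (hed z₀ hz₀))
          ((H.differentiableAt_normal hz₀).fun_const_smul h),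
        fderiv_fun_smul hrd (hed z₀ hz₀), fderiv_fun_const_smul (H.differentiableAt_normal hz₀),
        hdP z₀ hz₀]
      simp only [sub_apply, add_apply, smul_apply, ContinuousLinearMap.smulRight_apply, hrw,
        zero_smul, add_zero, smul_sub, smul_smul, mul_div_cancel₀ _ hs₀pos.ne']
      rfl
    have hPP : mink (P z₀) (P z₀) = -1 ∧ mink (Q z₀) (Q z₀) = 1 ∧ mink (P z₀) (Q z₀) = 0 := by
      simp only [hP, hQ, mink_sub_left, mink_sub_right, mink_smul_left, mink_smul_right, hee, hen,
        mink_comm (n z₀) (e z₀), H.unit z₀ hz₀]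
      refine ⟨?_, ?_, ?_⟩ <;> field_simp <;> linarith
    refine H.eq_zero_of_fderiv_eq_zero hz₀ ?_
    rw [hdf]
    refine smul_eq_zero_of_right _ (eq_zero_of_mink_frame (v := P z₀) (w := Q z₀) ?_ ?_ ?_ hw₂)
    · rw [mink_lcross_lcross, hPP.1, hPP.2.1, hPP.2.2]; norm_num
    · rw [hdf, hfe, mink_smul_left, mink_smul_right, mink_comm] at hfw
      simpa [hs₀pos.ne'] using hfw
    · rw [hdP z₀ hz₀]
      have h1 := mink_fderiv_add_of_eventually_const (c := 1) (hed z₀ hz₀) (hed z₀ hz₀)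
        (Filter.eventually_of_mem (H.isOpen.mem_nhds hz₀) fun y hy => (hre y hy).2.2.2.2.2.1) w
      rw [mink_comm (e z₀)] at h1
      simp only [hQ, mink_sub_left, mink_sub_right, mink_smul_left, mink_smul_right, hdne,
        mink_comm _ (n z₀), H.mink_normal_fderiv_normal hz₀]
      rw [mink_comm (n z₀), hden]
      rw [show mink (fderiv ℝ e z₀ w) (e z₀) = 0 by linarith]
      ring
  · intro z hz
    obtain ⟨hrs, hes, hrpos, -, hf, hee, hen, hden, hdne, hdr, X, hX, heX, hnX⟩ := hre z hz
    refine ⟨hss z hz, (hes.const_smul _).sub ((H.smooth_normal z hz).const_smul _),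
      ((H.smooth_normal z hz).const_smul _).sub (hes.const_smul _), hspos z hz, hslt z hz,
      ?_, ?_, ?_, ?_, ?_, X, ?_, ?_, ?_⟩
    · simp only [hP, mink_sub_left, mink_sub_right, mink_smul_left, mink_smul_right, hee, hen,
        mink_comm (n z) (e z), H.unit z hz]
      field_simp
      linarith
    · simp only [hQ, mink_sub_left, mink_sub_right, mink_smul_left, mink_smul_right, hee, hen,
        mink_comm (n z) (e z), H.unit z hz]
      field_simp
      linarith
    · simp only [hP, hQ, mink_sub_left, mink_sub_right, mink_smul_left, mink_smul_right, hee, hen,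
        mink_comm (n z) (e z), H.unit z hz]
      ring
    · intro w
      have h1 := mink_fderiv_add_of_eventually_const (c := 1) (hed z hz) (hed z hz)
        (Filter.eventually_of_mem (H.isOpen.mem_nhds hz) fun y hy => (hre y hy).2.2.2.2.2.1) w
      rw [mink_comm (e z)] at h1
      rw [hdP z hz]
      simp only [hQ, mink_sub_left, mink_sub_right, mink_smul_left, mink_smul_right, hden, hdne,
        mink_comm (fderiv ℝ n z w) (n z), H.mink_normal_fderiv_normal hz]
      rw [show mink (fderiv ℝ e z w) (e z) = 0 by linarith]
      ring
    · obtain ⟨c0, s0⟩ := hcosh z₀ hz₀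
      obtain ⟨c1, s1⟩ := hcosh z hz
      have hsz := (hspos z hz).ne'
      rw [Real.cosh_sub, Real.sinh_sub, c0, s0, c1, s1]
      conv_lhs => rw [hf]
      -- `e1` and `e2` compare the coefficients of `e` and `n` with those in `f = r e - h n`.
      have e1 : s z * ((|h| / s₀ * (|h| / s z) - r₀ / s₀ * (r z / s z)) * (r₀ / s₀)
          - (r₀ / s₀ * (|h| / s z) - |h| / s₀ * (r z / s z)) * (|h| / h) * (h / s₀)) = r z := by
        field_simp
        rw [sq_abs, ← hsr₀]
        ring
      have e2 : s z * ((r₀ / s₀ * (|h| / s z) - |h| / s₀ * (r z / s z)) * (|h| / h) * (r₀ / s₀)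
          - (|h| / s₀ * (|h| / s z) - r₀ / s₀ * (r z / s z)) * (h / s₀)) = -h := by
        field_simp
        rw [sq_abs]
        linear_combination h ^ 2 * hsr₀
      simp only [hP, hQ]
      rw [sub_eq_add_neg, ← neg_smul, ← e2]
      nth_rewrite 1 [← e1]
      module
    -- Along a ruling `s ds(X) = -⟨f, r e⟩ = -r²`, which is non-zero.
    · intro h0
      have h1 := hds z hz X
      rw [h0, hX, hf, mink_sub_left, mink_smul_left, mink_smul_left, mink_smul_right,
        mink_smul_right, hee, mink_comm (n z), hen] at h1
      nlinarith
    · rw [hdP z hz, heX, hnX]; simp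
    · rw [hdQ z hz, heX, hnX]; simp

end SpacelikePatch

/-! ### Coordinates in which a flat generalized constant ratio patch has the normal form -/

theorem contDiffOn_sub_arcosh (c₁ c₂ : ℝ) {I : Set ℝ} (hI : ∀ s ∈ I, 1 < c₂ / s) :
    ContDiffOn ℝ ∞ (fun s => c₁ - Real.arcosh (c₂ / s)) I := by
  intro s hs
  -- Division by zero returns 0, so `1 < c₂ / s` already excludes `s = 0`. Its strictness keeps
  -- `arcosh` away from its singular point 1.
  have hs0 : s ≠ 0 := by
    rintro rfl
    have := hI 0 hs
    rw [div_zero] at this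
    linarith
  exact (contDiffAt_const.sub ((Real.contDiffAt_arcosh (hI s hs)).comp s
    (contDiffAt_const.div contDiffAt_id hs0))).contDiffWithinAt

namespace SpacelikePatch

variable {f n : Plane → E31} {U : Set Plane}

/-- The frame vectors `P` and `Q` are constant along the rulings, so they are functions of any
transverse `τ`. Reparametrizing `P` by arc length turns it into `φ`, and `P ⊥ Q`, `dP ⊥ Q` identify
`Q` with `φ ∧ φ'` up to sign. -/
theorem exists_gcr_coordinates {h : ℝ} {z₀ : Plane} (H : SpacelikePatch f n U) (hz₀ : z₀ ∈ U)
    (hh : ∀ z ∈ U, mink (f z) (n z) = h) (hcone : ∀ z ∈ U, mink (f z) (f z) < 0)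
    (hT : ∀ z ∈ U, ∃ X, X ≠ 0 ∧ fderiv ℝ f z X = f z + h • n z) :
    ∃ (c₁ c₂ : ℝ) (φ : ℝ → E31) (J : Set ℝ) (g : OpenPartialHomeomorph Plane Plane),
      IsOpen J ∧ J.OrdConnected ∧ IsArclengthCurveInH2 φ J ∧ z₀ ∈ g.source ∧ g.source ⊆ U ∧
      (∀ z ∈ g.source, ContDiffAt ℝ ∞ g z) ∧ (∀ y ∈ g.target, ContDiffAt ℝ ∞ g.symm y) ∧
      ∀ z ∈ g.source, g z 0 ∈ Set.Ioo 0 c₂ ∧ g z 1 ∈ J ∧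
        f z = gcrMap (fun s => c₁ - Real.arcosh (c₂ / s)) φ (g z 0) (g z 1) := by
  obtain ⟨c₁, c₂, σ, s, P, Q, hσ, hinj, hfr⟩ := H.exists_gcr_frame hz₀ hh hcone hT
  have hPd : ∀ z ∈ U, DifferentiableAt ℝ P z := fun z hz =>
    (hfr z hz).2.1.differentiableAt (by simp)
  have hQd : ∀ z ∈ U, DifferentiableAt ℝ Q z := fun z hz =>
    (hfr z hz).2.2.1.differentiableAt (by simp)
  set ℓ := lcross (P z₀) (Q z₀) with hℓ
  set τ : Plane → ℝ := fun z => mink (P z) ℓ with hτ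
  have hτs : ∀ z ∈ U, ContDiffAt ℝ ∞ τ z := fun z hz => (hfr z hz).2.1.mink contDiffAt_const
  have hdτ : ∀ z ∈ U, ∀ w, fderiv ℝ τ z w = mink (fderiv ℝ P z w) ℓ := fun z hz w => by
    rw [hτ, fderiv_mink (hPd z hz) (differentiableAt_const ℓ)]
    simp [mink_zero_right]
  obtain ⟨γ, ε, V, hε, hV, hzV, hVU, hγ₀, hγ, hfac⟩ := exists_section (s := s) (τ := τ) H.isOpen hz₀
    (fun z hz => (hfr z hz).1) hτs (fun w hw₁ hw₂ => hinj w hw₁ (by rwa [hdτ z₀ hz₀] at hw₂))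
  set t₀ := τ z₀ with ht₀
  set p : ℝ → E31 := fun t => P (γ t) with hp
  set q : ℝ → E31 := fun t => Q (γ t) with hq
  have hps : ∀ t ∈ Metric.ball t₀ ε, ContDiffAt ℝ ∞ p t := fun t ht =>
    (hfr _ (hγ t ht).1).2.1.comp t (hγ t ht).2.1
  have hqs : ∀ t ∈ Metric.ball t₀ ε, ContDiffAt ℝ ∞ q t := fun t ht =>
    (hfr _ (hγ t ht).1).2.2.1.comp t (hγ t ht).2.1
  have hpd : ∀ t ∈ Metric.ball t₀ ε, DifferentiableAt ℝ p t := fun t ht =>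
    (hps t ht).differentiableAt (by simp)
  have hPp : ∀ z ∈ V, P z = p (τ z) := fun z hz =>
    (hfac z hz).2 P fun y hy => ⟨hPd y hy, by
      obtain ⟨-, -, -, -, -, -, -, -, -, -, X, hX₁, hX₂, -⟩ := hfr y hy
      exact ⟨X, hX₁, by rw [hdτ y hy, hX₂, mink_zero_left], hX₂⟩⟩
  have hQq : ∀ z ∈ V, Q z = q (τ z) := fun z hz =>
    (hfac z hz).2 Q fun y hy => ⟨hQd y hy, by
      obtain ⟨-, -, -, -, -, -, -, -, -, -, X, hX₁, hX₂, hX₃⟩ := hfr y hy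
      exact ⟨X, hX₁, by rw [hdτ y hy, hX₂, mink_zero_left], hX₃⟩⟩
  have hpp : ∀ t ∈ Metric.ball t₀ ε, mink (p t) (p t) = -1 := fun t ht =>
    (hfr _ (hγ t ht).1).2.2.2.2.2.1
  have hqq : ∀ t ∈ Metric.ball t₀ ε, mink (q t) (q t) = 1 := fun t ht =>
    (hfr _ (hγ t ht).1).2.2.2.2.2.2.1
  have hpq : ∀ t ∈ Metric.ball t₀ ε, mink (p t) (q t) = 0 := fun t ht =>
    (hfr _ (hγ t ht).1).2.2.2.2.2.2.2.1
  have hp'p : ∀ t ∈ Metric.ball t₀ ε, mink (deriv p t) (p t) = 0 := fun t ht => by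
    have := mink_deriv_add_of_eventually_const (c := -1) (hpd t ht) (hpd t ht)
      (Filter.eventually_of_mem (Metric.isOpen_ball.mem_nhds ht) hpp)
    rw [mink_comm (p t)] at this
    linarith
  have hp'q : ∀ t ∈ Metric.ball t₀ ε, mink (deriv p t) (q t) = 0 := fun t ht => by
    have h1 := (hPd _ (hγ t ht).1).hasFDerivAt.comp_hasDerivAt t
      ((hγ t ht).2.1.differentiableAt (by simp)).hasDerivAt
    rw [show deriv p t = _ from h1.deriv]
    exact (hfr _ (hγ t ht).1).2.2.2.2.2.2.2.2.1 _
  -- the velocity of `p`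
  set l : ℝ → ℝ := fun t => -σ * mink (deriv p t) (lcross (p t) (q t)) with hl
  -- `l` is a signed speed. The factor `-σ` gives `φ' = -σ p ∧ q` after reparametrization, whence `φ
  -- ∧ φ' = σ q`, the vector occurring in the frame formula.
  have hp' : ∀ t ∈ Metric.ball t₀ ε, deriv p t = l t • (-σ) • lcross (p t) (q t) := fun t ht => by
    conv_lhs => rw [eq_smul_lcross (hpp t ht) (hqq t ht) (hpq t ht) (hp'p t ht) (hp'q t ht)]
    rw [smul_smul, hl]
    congr 1
    linear_combination (-mink (deriv p t) (lcross (p t) (q t))) * hσ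
  have hls : ∀ t ∈ Metric.ball t₀ ε, ContDiffAt ℝ ∞ l t := fun t ht => by
    have hp's : ContDiffAt ℝ ∞ (deriv p) t :=
      ((contDiffOn_infty_iff_deriv_of_isOpen Metric.isOpen_ball).mp
        (fun t ht => (hps t ht).contDiffWithinAt)).2.contDiffAt (Metric.isOpen_ball.mem_nhds ht)
    exact contDiffAt_const.mul (hp's.mink ((hps t ht).lcross (hqs t ht)))
  have ht₀ε : t₀ ∈ Metric.ball t₀ ε := Metric.mem_ball_self hε
  have hσ0 : σ ≠ 0 := by rintro rfl; norm_num at hσ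
  have hl₀ : l t₀ ≠ 0 := by
    -- `⟨p(t), ℓ⟩ = τ(γ(t)) = t` has derivative 1, so `l(t₀) = -σ` and the primitive `A` is
    -- invertible near `t₀`.
    have h1 : deriv (fun t => mink (p t) ℓ) t₀ = 1 := by
      have : (fun t => mink (p t) ℓ) =ᶠ[nhds t₀] fun t => t := by
        filter_upwards [Metric.isOpen_ball.mem_nhds ht₀ε] with t ht using (hγ t ht).2.2
      rw [this.deriv_eq, deriv_id'']
    rw [deriv_mink (hpd t₀ ht₀ε) (differentiableAt_const ℓ), deriv_const, mink_zero_right,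
      add_zero] at h1
    have h2 : l t₀ = -σ * 1 := by
      rw [← h1, hl, hℓ, hp, hq]
      simp only [hγ₀]
    rw [h2]
    simpa using hσ0
  -- the arc length function and its inverse
  obtain ⟨A, hAs, hA⟩ := exists_smooth_primitive hls
  obtain ⟨B, hB₀, hBsub, hBA, hBs, hBinj⟩ := exists_openPartialHomeomorph_of_fderiv_injective
    Metric.isOpen_ball ht₀ε hAs (fun w hw => by
      rw [(hA t₀ ht₀ε).hasFDerivAt.fderiv] at hw
      simpa [hl₀] using hw)
  have hBt₀ : A t₀ ∈ B.target := by
    have := B.map_source hB₀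
    rwa [hBA] at this
  obtain ⟨δ, hδ, hδsub⟩ := Metric.mem_nhds_iff.mp (B.open_target.mem_nhds hBt₀)
  set J := Metric.ball (A t₀) δ with hJ
  have hmem : ∀ t ∈ J, B.symm t ∈ Metric.ball t₀ ε := fun t ht =>
    hBsub (B.map_target (hδsub ht))
  have hlne : ∀ t ∈ J, l (B.symm t) ≠ 0 := fun t ht h0 => by
    have := hBinj (B.symm t) (B.map_target (hδsub ht)) 1
    rw [(hA _ (hmem t ht)).hasFDerivAt.fderiv] at this
    simp [h0] at this
  set φ : ℝ → E31 := fun t => p (B.symm t) with hφ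
  have hφ' : ∀ t ∈ J, deriv φ t = (-σ) • lcross (p (B.symm t)) (q (B.symm t)) := fun t ht => by
    have h1 : HasDerivAt B.symm (l (B.symm t))⁻¹ t :=
      B.hasDerivAt_symm (hδsub ht) (hlne t ht) (by rw [hBA]; exact hA _ (hmem t ht))
    have h2 := (hpd _ (hmem t ht)).hasDerivAt.scomp t h1
    rw [show deriv φ t = _ from h2.deriv, hp' _ (hmem t ht), smul_smul,
      inv_mul_cancel₀ (hlne t ht), one_smul]
  have hφψ : ∀ t ∈ J, lcross (φ t) (deriv φ t) = σ • q (B.symm t) := fun t ht => by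
    rw [hφ' t ht, lcross_smul_right, hφ, lcross_lcross, hpp _ (hmem t ht), hpq _ (hmem t ht)]
    module
  -- the coordinates
  have hτc : ContinuousOn τ V := fun z hz =>
    (hτs z (hVU hz)).continuousAt.continuousWithinAt
  set W : Set Plane := V ∩ τ ⁻¹' (B.source ∩ B ⁻¹' J) with hW
  have hWo : IsOpen W :=
    hτc.isOpen_inter_preimage hV (B.isOpen_inter_preimage Metric.isOpen_ball)
  have hzW : z₀ ∈ W := ⟨hzV, hB₀, by
    rw [Set.mem_preimage, hBA]; exact Metric.mem_ball_self hδ⟩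
  have hAτs : ∀ z ∈ W, ContDiffAt ℝ ∞ (fun y => A (τ y)) z := fun z hz =>
    (hAs _ (hBsub hz.2.1)).comp z (hτs z (hVU hz.1))
  have hGs : ∀ z ∈ W, ContDiffAt ℝ ∞ (fun y => planePt (s y) (A (τ y))) z := fun z hz =>
    (hfr z (hVU hz.1)).1.planePt (hAτs z hz)
  obtain ⟨g, hg₀, hgW, hgG, hgs, -⟩ := exists_openPartialHomeomorph_of_fderiv_injective hWo hzW hGs
    (fun w hw => by
      have hsd : DifferentiableAt ℝ s z₀ := (hfr z₀ hz₀).1.differentiableAt (by simp)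
      have hAd : DifferentiableAt ℝ (fun y => A (τ y)) z₀ :=
        (hAτs z₀ hzW).differentiableAt (by simp)
      rw [fderiv_planePt hsd hAd] at hw
      have e0 := congrArg (fun y : Plane => y 0) hw
      have e1 := congrArg (fun y : Plane => y 1) hw
      simp only [planePt_zero, planePt_one, PiLp.zero_apply] at e0 e1
      refine hinj w e0 ?_
      have hτd : HasFDerivAt τ (fderiv ℝ τ z₀) z₀ :=
        ((hτs z₀ hz₀).differentiableAt (by simp)).hasFDerivAt
      have := (hA t₀ ht₀ε).comp_hasFDerivAt z₀ hτd
      rw [show fderiv ℝ (fun y => A (τ y)) z₀ = _ from this.fderiv] at e1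
      rw [← hdτ z₀ hz₀]
      simpa [hl₀] using e1)
  have hgz : ∀ z, g z = planePt (s z) (A (τ z)) := fun z => congrFun hgG z
  refine ⟨c₁, c₂, φ, J, g, Metric.isOpen_ball, ?_, ⟨?_, ?_⟩, hg₀, fun z hz => hVU (hgW hz).1, ?_,
    hgs, ?_⟩
  · rw [hJ, Real.ball_eq_Ioo]; exact Set.ordConnected_Ioo
  · exact fun t ht =>
      ((hps _ (hmem t ht)).comp t (hBs t (hδsub ht))).contDiffWithinAt
  · intro t ht
    refine ⟨hpp _ (hmem t ht), ?_⟩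
    rw [hφ' t ht, mink_smul_left, mink_smul_right, mink_lcross_lcross, hpp _ (hmem t ht),
      hqq _ (hmem t ht), hpq _ (hmem t ht)]
    linear_combination hσ
  · intro z hz
    rw [hgG]
    exact hGs z (hgW hz)
  · intro z hz
    obtain ⟨hzV, hzB, hzJ⟩ := hgW hz
    rw [Set.mem_preimage, hBA] at hzJ
    obtain ⟨-, -, -, hspos, hslt, -, -, -, -, hf, -⟩ := hfr z (hVU hzV)
    have hBAz : B.symm (A (τ z)) = τ z := by
      have := B.left_inv hzB
      rwa [hBA] at this
    rw [hgz, planePt_zero, planePt_one]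
    refine ⟨⟨hspos, hslt⟩, hzJ, ?_⟩
    rw [gcrMap, hφψ _ hzJ]
    simp only [hφ, hBAz]
    rw [← hPp z hzV, ← hQq z hzV]
    exact hf

/-- A patch in normal form has stationary support function, and the tangential part of the position
vector does not vanish. -/
theorem of_eq_gcrMap (H : SpacelikePatch f n U) {c₁ c₂ : ℝ} {I J : Set ℝ} {φ : ℝ → E31}
    (hI : ∀ s ∈ I, 1 < c₂ / s) (hJ : IsOpen J) (hφ : IsArclengthCurveInH2 φ J)
    (hf : ∀ z ∈ U, z 0 ∈ I ∧ z 1 ∈ J ∧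
      f z = gcrMap (fun s => c₁ - Real.arcosh (c₂ / s)) φ (z 0) (z 1)) {z : Plane} (hz : z ∈ U) :
    fderiv ℝ (fun y => mink (f y) (n y)) z = 0 ∧ f z + mink (f z) (n z) • n z ≠ 0 := by
  have hφs : ∀ t ∈ J, ContDiffAt ℝ ∞ φ t := fun t ht => hφ.1.contDiffAt (hJ.mem_nhds ht)
  have hφ's : ∀ t ∈ J, ContDiffAt ℝ ∞ (deriv φ) t := fun t ht =>
    ((contDiffOn_infty_iff_deriv_of_isOpen hJ).mp hφ.1).2.contDiffAt (hJ.mem_nhds ht)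
  set ψ : ℝ → E31 := fun t => lcross (φ t) (deriv φ t) with hψ
  have hφd : ∀ t ∈ J, DifferentiableAt ℝ φ t := fun t ht => (hφs t ht).differentiableAt (by simp)
  have hψd : ∀ t ∈ J, DifferentiableAt ℝ ψ t := fun t ht =>
    ((hφs t ht).lcross (hφ's t ht)).differentiableAt (by simp)
  have hφφ' : ∀ t ∈ J, mink (φ t) (deriv φ t) = 0 := fun t ht => by
    have := mink_deriv_add_of_eventually_const (c := -1) (hφd t ht) (hφd t ht)
      (Filter.eventually_of_mem (hJ.mem_nhds ht) fun y hy => (hφ.2 y hy).1)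
    rw [mink_comm (deriv φ t)] at this
    linarith
  have hψψ : ∀ t ∈ J, mink (ψ t) (ψ t) = 1 := fun t ht => by
    rw [hψ, mink_lcross_lcross, hφφ' t ht, (hφ.2 t ht).1, (hφ.2 t ht).2]
    norm_num
  have hψφ : ∀ t, mink (ψ t) (φ t) = 0 := fun t => mink_lcross_left _ _
  have hψφ' : ∀ t, mink (ψ t) (deriv φ t) = 0 := fun t => mink_lcross_right _ _
  have hψ'φ : ∀ t ∈ J, mink (deriv ψ t) (φ t) = 0 := fun t ht => by
    have := mink_deriv_add_of_eventually_const (c := 0) (hψd t ht) (hφd t ht)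
      (Filter.Eventually.of_forall hψφ)
    rw [hψφ'] at this
    linarith
  have hψ'ψ : ∀ t ∈ J, mink (deriv ψ t) (ψ t) = 0 := fun t ht => by
    have := mink_deriv_add_of_eventually_const (c := 1) (hψd t ht) (hψd t ht)
      (Filter.eventually_of_mem (hJ.mem_nhds ht) hψψ)
    rw [mink_comm (ψ t)] at this
    linarith
  have hs0 : ∀ y ∈ U, y 0 ≠ 0 := fun y hy h0 => by
    have := hI _ (hf y hy).1
    rw [h0, div_zero] at this
    linarith
  -- the position vector
  have hff : ∀ y ∈ U, mink (f y) (f y) = -(y 0) ^ 2 := fun y hy => by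
    obtain ⟨-, hyJ, hfy⟩ := hf y hy
    change f y = y 0 • (_ • φ (y 1) + _ • ψ (y 1)) at hfy
    rw [hfy]
    simp only [mink_smul_left, mink_smul_right, mink_add_left, mink_add_right, hψψ _ hyJ, hψφ,
      mink_comm (φ (y 1)) (ψ (y 1)), (hφ.2 _ hyJ).1]
    linear_combination (-(y 0) ^ 2) *
      Real.cosh_sq_sub_sinh_sq (c₁ - Real.arcosh (c₂ / y 0))
  have hff' : ∀ w, mink (f z) (fderiv ℝ f z w) = -(z 0 * w 0) := fun w => by
    have h1 := fderiv_mink (H.differentiableAt hz) (H.differentiableAt hz) w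
    have h2 : (fun y => mink (f y) (f y)) =ᶠ[nhds z] fun y => -(y 0) ^ 2 := by
      filter_upwards [H.isOpen.mem_nhds hz] with y hy using hff y hy
    have h3 : HasFDerivAt (fun y : Plane => y 0) (EuclideanSpace.proj (𝕜 := ℝ) (0 : Fin 2)) z :=
      (EuclideanSpace.proj (𝕜 := ℝ) (0 : Fin 2)).hasFDerivAt
    have h4 := (h3.pow 2).neg
    rw [h2.fderiv_eq, show fderiv ℝ (fun y : Plane => -(y 0) ^ 2) z = _ from h4.fderiv,
      mink_comm (fderiv ℝ f z w)] at h1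
    simp at h1
    linarith
  -- the normal
  set ν : ℝ → E31 := fun t => Real.cosh c₁ • φ t + Real.sinh c₁ • ψ t with hν
  have hνd : ∀ t ∈ J, HasDerivAt ν (Real.cosh c₁ • deriv φ t + Real.sinh c₁ • deriv ψ t) t :=
    fun t ht => ((hφd t ht).hasDerivAt.fun_const_smul _).fun_add ((hψd t ht).hasDerivAt.fun_const_smul _)
  have hνν : ∀ t ∈ J, mink (ν t) (ν t) = -1 := fun t ht => by
    simp only [hν, mink_smul_left, mink_smul_right, mink_add_left, mink_add_right, hψψ _ ht, hψφ,
      mink_comm (φ t) (ψ t), (hφ.2 _ ht).1]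
    linear_combination -Real.cosh_sq_sub_sinh_sq c₁
  -- The product is `-s cosh(c₁ - u) = -s cosh(arcosh(c₂ / s)) = -c₂`.
  have hfν : ∀ y ∈ U, mink (f y) (ν (y 1)) = -c₂ := fun y hy => by
    obtain ⟨hyI, hyJ, hfy⟩ := hf y hy
    change f y = y 0 • (_ • φ (y 1) + _ • ψ (y 1)) at hfy
    rw [hfy]
    simp only [hν, mink_smul_left, mink_smul_right, mink_add_left, mink_add_right, hψψ _ hyJ, hψφ,
      mink_comm (φ (y 1)) (ψ (y 1)), (hφ.2 _ hyJ).1]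
    have h1 := Real.cosh_sub c₁ (c₁ - Real.arcosh (c₂ / y 0))
    rw [sub_sub_cancel, Real.cosh_arcosh (hI _ hyI).le, div_eq_iff (hs0 y hy)] at h1
    linear_combination h1
  have hνf : ∀ y ∈ U, ∀ w, mink (ν (y 1)) (fderiv ℝ f y w) = 0 := fun y hy w => by
    obtain ⟨hyI, hyJ, hfy⟩ := hf y hy
    have h3 : HasFDerivAt (fun y : Plane => y 1) (EuclideanSpace.proj (𝕜 := ℝ) (1 : Fin 2)) y :=
      (EuclideanSpace.proj (𝕜 := ℝ) (1 : Fin 2)).hasFDerivAt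
    have h4 : HasFDerivAt (fun y : Plane => ν (y 1)) _ y :=
      HasFDerivAt.comp (g := ν) (f := fun y : Plane => y 1) y (hνd (y 1) hyJ).hasFDerivAt h3
    have h5 := mink_fderiv_add_of_eventually_const (c := -c₂) (H.differentiableAt hy)
      h4.differentiableAt
      (Filter.eventually_of_mem (H.isOpen.mem_nhds hy) hfν) w
    rw [h4.fderiv] at h5
    -- `φ'` and `ψ'` are orthogonal to both `φ` and `ψ`, hence to `f`. Differentiating `⟨f, ν⟩ =
    -- -c₂` then leaves `⟨df, ν⟩ = 0`: `ν` is normal.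
    have h6 : mink (f y) (Real.cosh c₁ • deriv φ (y 1) + Real.sinh c₁ • deriv ψ (y 1)) = 0 := by
      change f y = y 0 • (_ • φ (y 1) + _ • ψ (y 1)) at hfy
      rw [hfy]
      simp only [mink_smul_left, mink_smul_right, mink_add_left, mink_add_right, hψφ',
        hφφ' _ hyJ, mink_comm _ (deriv ψ (y 1)), hψ'φ _ hyJ, hψ'ψ _ hyJ]
      ring
    have h7 : mink (f y) (w 1 • (Real.cosh c₁ • deriv φ (y 1) + Real.sinh c₁ • deriv ψ (y 1)))
        = 0 := by rw [mink_smul_right, h6, mul_zero]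
    rw [smul_add] at h7
    rw [mink_comm]
    simpa [h7] using h5
  have hn : ∀ y ∈ U, ν (y 1) = (-mink (ν (y 1)) (n y)) • n y := fun y hy => by
    refine sub_eq_zero.mp (H.eq_zero_of_mink_eq_zero hy ?_ fun w => ?_)
    · rw [mink_sub_right, mink_smul_right, H.unit y hy, mink_comm]
      ring
    · rw [mink_sub_left, mink_smul_left, H.normal y hy, hνf y hy]
      ring
  -- `ν` equals `n` only up to sign, so the support function is controlled through its square, which
  -- is the constant `c₂²`.
  have hsq : ∀ y ∈ U, mink (f y) (n y) * mink (f y) (n y) = c₂ ^ 2 := fun y hy => by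
    have h1 := hνν _ (hf y hy).2.1
    have h2 := hfν y hy
    rw [hn y hy, mink_smul_right] at h2
    rw [hn y hy, mink_smul_left, mink_smul_right, H.unit y hy] at h1
    set a := -mink (ν (y 1)) (n y)
    have h3 : a * a = 1 := by linarith
    calc mink (f y) (n y) * mink (f y) (n y)
        = (a * mink (f y) (n y)) ^ 2 := by
          linear_combination (-mink (f y) (n y) * mink (f y) (n y)) * h3
      _ = c₂ ^ 2 := by rw [h2]; ring
  have hc₂ : c₂ ≠ 0 := by
    rintro rfl
    have := hI _ (hf z hz).1
    rw [zero_div] at this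
    linarith
  have hne : mink (f z) (n z) ≠ 0 := by
    intro h0
    have := hsq z hz
    rw [h0, zero_mul] at this
    exact hc₂ (pow_eq_zero_iff two_ne_zero |>.mp this.symm)
  refine ⟨?_, ?_⟩
  · have hd := (H.differentiableAt hz).mink (H.differentiableAt_normal hz)
    have h1 : (fun y => mink (f y) (n y) * mink (f y) (n y)) =ᶠ[nhds z] fun _ => c₂ ^ 2 := by
      filter_upwards [H.isOpen.mem_nhds hz] with y hy using hsq y hy
    have h2 := h1.fderiv_eq (𝕜 := ℝ)
    rw [fderiv_fun_mul hd hd, fderiv_fun_const] at h2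
    refine ContinuousLinearMap.ext fun w => ?_
    have h3 := congrArg (fun L : Plane →L[ℝ] ℝ => L w) h2
    simp only [add_apply, smul_apply, smul_eq_mul] at h3
    have h4 : mink (f z) (n z) * fderiv ℝ (fun y => mink (f y) (n y)) z w = 0 := by
      change _ = (0 : ℝ) at h3
      linarith
    exact (mul_eq_zero.mp h4).resolve_left hne
  · intro h0
    have h1 := H.mink_tangential_fderiv hz (coordVec 0)
    rw [h0, mink_zero_left, hff'] at h1
    simp at h1
    exact hs0 z hz h1

end SpacelikePatch

/-! ### Surfaces in charts -/

section Charts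

variable {M : Type*} [TopologicalSpace M] [ChartedSpace Plane M]
  {x N : M → E31} {e : OpenPartialHomeomorph M Plane}

theorem contDiffAt_comp_symm (he : e ∈ IsManifold.maximalAtlas (𝓡 2) ∞ M)
    (hx : ContMDiff (𝓡 2) 𝓘(ℝ, E31) ∞ x) {z : Plane} (hz : z ∈ e.target) :
    ContDiffAt ℝ ∞ (x ∘ e.symm) z :=
  ((hx.contMDiffAt).comp z (contMDiffAt_symm_of_mem_maximalAtlas he hz)).contDiffAt

theorem mdifferentiable_of_mem_maximalAtlas (he : e ∈ IsManifold.maximalAtlas (𝓡 2) ∞ M) :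
    e.MDifferentiable (𝓡 2) (𝓡 2) :=
  ⟨(contMDiffOn_of_mem_maximalAtlas he).mdifferentiableOn (by simp),
    (contMDiffOn_symm_of_mem_maximalAtlas he).mdifferentiableOn (by simp)⟩

/-- The differential of a chart of the maximal atlas. -/
theorem exists_chart_differential (he : e ∈ IsManifold.maximalAtlas (𝓡 2) ∞ M) {z : Plane}
    (hz : z ∈ e.target) :
    ∃ L : Plane →L[ℝ] TangentSpace (𝓡 2) (e.symm z), Function.Bijective L ∧
      ∀ y : M → E31, ContMDiff (𝓡 2) 𝓘(ℝ, E31) ∞ y →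
        ∀ w, fderiv ℝ (y ∘ e.symm) z w = dmap y (e.symm z) (L w) := by
  have hd := mdifferentiable_of_mem_maximalAtlas he
  refine ⟨mfderiv (𝓡 2) (𝓡 2) e.symm z, hd.symm.mfderiv_bijective hz, fun y hy w => ?_⟩
  have h1 := mfderiv_comp z (hy.mdifferentiable (by simp) (e.symm z))
    (hd.mdifferentiableAt_symm hz)
  rw [mfderiv_eq_fderiv] at h1
  rw [h1]
  rfl

theorem spacelikePatch_comp_symm (hx : IsSpacelikeImmersion x) (hN : IsUnitNormal x N)
    (he : e ∈ IsManifold.maximalAtlas (𝓡 2) ∞ M) :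
    SpacelikePatch (x ∘ e.symm) (N ∘ e.symm) e.target where
  isOpen := e.open_target
  smooth _ hz := contDiffAt_comp_symm he hx.1 hz
  smooth_normal _ hz := contDiffAt_comp_symm he hN.1 hz
  pos z hz w hw := by
    obtain ⟨L, hL, hLd⟩ := exists_chart_differential he hz
    rw [hLd x hx.1]
    refine hx.2 _ _ fun h0 => hw (hL.1 ?_)
    rw [h0, map_zero]
  unit z _ := (hN.2 (e.symm z)).1
  normal z hz w := by
    obtain ⟨L, hL, hLd⟩ := exists_chart_differential he hz
    rw [hLd x hx.1]
    exact (hN.2 (e.symm z)).2 _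

/-- The generalized constant ratio condition in a chart. -/
theorem IsGCR.exists_principal (hx : IsSpacelikeImmersion x) (hN : IsUnitNormal x N)
    (hgcr : IsGCR x N) (he : e ∈ IsManifold.maximalAtlas (𝓡 2) ∞ M) {z : Plane}
    (hz : z ∈ e.target) : ∃ X, X ≠ 0 ∧
      fderiv ℝ (x ∘ e.symm) z X = (x ∘ e.symm) z + mink ((x ∘ e.symm) z) ((N ∘ e.symm) z) •
        (N ∘ e.symm) z ∧
      ∃ k : ℝ, fderiv ℝ (N ∘ e.symm) z X = -(k • fderiv ℝ (x ∘ e.symm) z X) := by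
  obtain ⟨L, hL, hLd⟩ := exists_chart_differential he hz
  obtain ⟨v, hv, hv0, k, hk⟩ := hgcr (e.symm z)
  obtain ⟨X, rfl⟩ := hL.2 v
  refine ⟨X, ?_, ?_, k, ?_⟩
  · rintro rfl
    exact hv0 (map_zero L)
  · refine (spacelikePatch_comp_symm hx hN he).fderiv_eq_tangential hz fun w => ?_
    rw [hLd x hx.1, hLd x hx.1]
    exact hv (L w)
  · rw [hLd x hx.1, hLd N hN.1]
    exact hk

variable [IsManifold (𝓡 2) ∞ M] in
/-- Changing a chart by a diffeomorphism of open subsets of the plane. -/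
theorem trans_mem_maximalAtlas (he : e ∈ IsManifold.maximalAtlas (𝓡 2) ∞ M)
    {g : OpenPartialHomeomorph Plane Plane} (hg : ∀ z ∈ g.source, ContDiffAt ℝ ∞ g z)
    (hgs : ∀ z ∈ g.target, ContDiffAt ℝ ∞ g.symm z) :
    e.trans g ∈ IsManifold.maximalAtlas (𝓡 2) ∞ M := by
  apply OpenPartialHomeomorph.mem_maximalAtlas_of_contMDiffOn
  · intro q hq
    rw [OpenPartialHomeomorph.trans_source] at hq
    exact ((hg _ hq.2).contMDiffAt.comp q
      (contMDiffAt_of_mem_maximalAtlas he hq.1)).contMDiffWithinAt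
  · intro y hy
    rw [OpenPartialHomeomorph.trans_target] at hy
    exact ((contMDiffAt_symm_of_mem_maximalAtlas he hy.2).comp y
      (hgs _ hy.1).contMDiffAt).contMDiffWithinAt

end Charts

/-! ### The equivalence on the surface -/

theorem mainTheorem3 {M : Type*} [TopologicalSpace M] [ChartedSpace Plane M]
    [IsManifold (𝓡 2) ∞ M] (x N : M → E31)
    (hx : IsSpacelikeImmersion x) (hN : IsUnitNormal x N) (hcone : LiesInTimelikeCone x) :
    (IsGCR x N ∧ IsFlatSurface x) ↔
      ∀ p : M, ∃ (c₁ c₂ : ℝ) (I : Set ℝ),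
        (∀ s ∈ I, 1 < c₂ / s) ∧
          IsGCRParametrizedNear x p (fun s => c₁ - Real.arcosh (c₂ / s)) I := by
  constructor
  · rintro ⟨hgcr, hflat⟩ p
    have he := IsManifold.chart_mem_maximalAtlas (I := 𝓡 2) (n := ∞) p
    set e := chartAt Plane p with he'
    have H := spacelikePatch_comp_symm hx hN he
    set f := x ∘ e.symm
    set n := N ∘ e.symm
    have hT := fun z (hz : z ∈ e.target) => hgcr.exists_principal hx hN he hz
    have hdh : ∀ z ∈ e.target, fderiv ℝ (fun y => mink (f y) (n y)) z = 0 := fun z hz =>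
      H.fderiv_support_eq_zero hT (fun y hy => H.exists_fderiv_normal_eq_zero hy
        (hflat e (chart_mem_atlas Plane p) y hy)) hz
    have hp : e p ∈ e.target := e.map_source (mem_chart_source Plane p)
    obtain ⟨ε, hε, hball⟩ := Metric.isOpen_iff.mp e.open_target _ hp
    -- A stationary support function is constant only on connected sets, hence the restriction to a
    -- ball in the chart.
    have hconst : ∀ z ∈ Metric.ball (e p) ε, mink (f z) (n z) = mink (f (e p)) (n (e p)) :=
      fun z hz => Metric.isOpen_ball.is_const_of_fderiv_eq_zero
        (f := fun y => mink (f y) (n y)) (convex_ball (e p) ε).isPreconnected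
        (fun y hy => ((H.differentiableAt (hball hy)).mink
          (H.differentiableAt_normal (hball hy))).differentiableWithinAt)
        (fun y hy => hdh y (hball hy)) hz (Metric.mem_ball_self hε)
    obtain ⟨c₁, c₂, φ, J, g, hJ, hJc, hφ, hg₀, hgU, hgs, hgs', hgf⟩ :=
      (H.mono Metric.isOpen_ball hball).exists_gcr_coordinates (Metric.mem_ball_self hε) hconst
        (fun z _ => hcone (e.symm z)) (fun z hz => by
          obtain ⟨X, hX0, hX, -⟩ := hT z (hball hz)
          exact ⟨X, hX0, by rw [← hconst z hz]; exact hX⟩)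
    have hI : ∀ s ∈ Set.Ioo 0 c₂, 1 < c₂ / s := fun s hs => by
      rw [lt_div_iff₀ hs.1, one_mul]; exact hs.2
    refine ⟨c₁, c₂, Set.Ioo 0 c₂, hI, isOpen_Ioo, Set.ordConnected_Ioo,
      contDiffOn_sub_arcosh c₁ c₂ hI, φ, J, hJ, hJc, hφ, e.trans g,
      trans_mem_maximalAtlas he hgs hgs', ?_, ?_⟩
    · rw [OpenPartialHomeomorph.trans_source]
      exact ⟨mem_chart_source Plane p, hg₀⟩
    · intro q hq
      rw [OpenPartialHomeomorph.trans_source] at hq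
      obtain ⟨h0, h1, h2⟩ := hgf (e q) hq.2
      refine ⟨h0, h1, ?_⟩
      rw [← e.left_inv hq.1]
      simpa [f, e.right_inv (e.map_source hq.1)] using h2
  · intro hloc
    -- A non-zero tangential part in the kernel of `dN` yields both conclusions: it is principal
    -- with eigenvalue 0, and it makes the Gauss curvature vanish in every chart.
    have key : ∀ p : M, ∃ v : TangentSpace (𝓡 2) p, v ≠ 0 ∧ IsTangentialPart x p v ∧
        dmap N p v = 0 := by
      intro p
      obtain ⟨c₁, c₂, I, hI, -, -, -, φ, J, hJ, -, hφ, e, he, hp, hxe⟩ := hloc p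
      have H := spacelikePatch_comp_symm hx hN he
      have hz := e.map_source hp
      obtain ⟨hdh, hT0⟩ := H.of_eq_gcrMap hI hJ hφ (fun z hz => by
        have := hxe (e.symm z) (e.map_target hz)
        rwa [e.right_inv hz] at this) hz
      obtain ⟨X, hX⟩ := H.exists_fderiv_eq hz (H.mink_normal_tangential hz)
      have hnX := H.fderiv_normal_eq_zero hz hdh hX
      obtain ⟨L, hL, hLd⟩ := exists_chart_differential he hz
      have hpe : e.symm (e p) = p := e.left_inv hp
      suffices h : ∃ v : TangentSpace (𝓡 2) (e.symm (e p)), v ≠ 0 ∧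
          IsTangentialPart x (e.symm (e p)) v ∧ dmap N (e.symm (e p)) v = 0 by
        rwa [hpe] at h
      refine ⟨L X, ?_, ?_, ?_⟩
      · intro h0
        have : X = 0 := hL.1 (by rw [h0, map_zero])
        rw [this, map_zero] at hX
        exact hT0 hX.symm
      · intro w
        obtain ⟨Y, rfl⟩ := hL.2 w
        rw [← hLd x hx.1, ← hLd x hx.1, hX, mink_sub_left, H.mink_tangential_fderiv hz]
        exact sub_self _
      · rw [← hLd N hN.1, hnX]
    refine ⟨fun p => ?_, fun e he z hz l k i j => ?_⟩
    · obtain ⟨v, hv0, hv, hNv⟩ := key p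
      exact ⟨v, hv, hv0, 0, by rw [hNv, zero_smul, neg_zero]⟩
    · have he' := IsManifold.subset_maximalAtlas (I := 𝓡 2) (n := ∞) he
      obtain ⟨v, hv0, -, hNv⟩ := key (e.symm z)
      obtain ⟨L, hL, hLd⟩ := exists_chart_differential he' hz
      obtain ⟨X, rfl⟩ := hL.2 v
      refine (spacelikePatch_comp_symm hx hN he').riemann_eq_zero hz (v := X) ?_ ?_ l k i j
      · rintro rfl
        exact hv0 (map_zero L)
      · rw [hLd N hN.1, hNv]

end
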